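/- Setting. Let $(V,\delta)$ be a metric space of doubling dimension at most the real number $d\ge0$ (every ball of radius $2r$ is covered by at most $2^d$ balls of radius $r$; we read $0^0=1$). Let $x_1,\dots,x_n\in V$ be data points and $y_1,\dots,y_m\in V$ candidate centres (repetitions allowed), and let $k\ge 1$. A solution is a set $S$ of exactly $k$ candidates, with cost $\mathrm{cost}(S)=\sum_j \min_{i\in S}\delta(x_j,y_i)^2$. A $\rho$-swap replaces $S$ by $(S\setminus Q)\cup P$, where $Q\subseteq S$, $P\cap S=\emptyset$ and $|P|=|Q|\le\rho$. A solution $S$ is locally optimal with tolerance $\theta\ge0$ for $\rho$-swaps if $\mathrm{cost}(S')\ge(1-\theta)\,\mathrm{cost}(S)$ for every $S'$ obtained from $S$ by a $\rho$-swap; it is locally optimal if this holds with $\theta=0$. Theorem. (1) There are absolute constants $K>0$ and $\varepsilon_0\in(0,1)$ such that for all $0<\varepsilon\le\varepsilon_0$, all $d$ and all instances as above, the following holds with $\rho=32\,d^{16d}\,\varepsilon^{-256d/\varepsilon}$. If a solution $S$ is locally optimal for $\rho$-swaps, or is locally optimal for $\rho$-swaps with tolerance $\varepsilon/k$, then $\mathrm{cost}(S)\le(1+K\varepsilon)\,\mathrm{cost}(O)$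 for every solution $O$. (2) There are absolute constants $c>0$ and $B\in\mathbb N$ such that for all $d$ and all $0<\varepsilon\le 1/2$, with $\rho=d^{cd}\,\varepsilon^{-cd/\varepsilon}$, the following hold. (2a) In every instance as above, each solution $S$ that is locally optimal for $\rho$-swaps satisfies $\mathrm{cost}(S)\le(1+\varepsilon)\,\mathrm{cost}(O)$ for every solution $O$. (2b) There is a number $A=A(d,\varepsilon)$ such that the following holds for every instance whose squared distances $\delta(x_j,y_i)^2$ are natural numbers in some common real unit, given in binary with total input length $L$. Put $N=\lceil c/\varepsilon\rceil$. Consider the local search that starts from an arbitrary solution and, as long as some $\rho$-swap $S'$ of the current solution $S$ has $\mathrm{cost}(S')<\left(1-\frac1{Nk}\right)\mathrm{cost}(S)$, moves to such an $S'$, found by trying all swaps. It halts after at most $A\cdot L^{B(\lfloor\rho\rfloor+1)}$ elementary steps, where arithmetic is charged by binary length and handling an index costs one step. Its output is a solution of cost at most $(1+\varepsilon)$ times the cost of every solution. So it is a PTAS for fixed $d$. (3) In any metric space, let $0<\varepsilon<1$, let $\rho$ be arbitrary, and let $O$ be an optimum solution with $\mathrm{cost}(O)>0$. If solutions $S_0,S_1,\dots,S_t$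 are such that each $S_{i+1}$ arises from $S_i$ by a $\rho$-swap with $\mathrm{cost}(S_{i+1})<(1-\varepsilon/k)\,\mathrm{cost}(S_i)$, then $$t\le \log\!\left(\frac{\mathrm{cost}(S_0)}{\mathrm{cost}(O)}\right)\Big/\log\!\left(\frac{1}{1-\varepsilon/k}\right).$$ -/

import Mathlib

universe u

namespace KMeans



/-! ### Doubling metrics, the k-means objective, swaps -/

/-- The doubling dimension of `V` is at most `d`: every ball of radius `2 r` is covered by at
most `2 ^ d` balls of radius `r`. -/
def DoublingDimLE (V : Type u) [MetricSpace V] (d : ℝ) : Prop :=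
  ∀ (p : V) (r : ℝ), 0 < r → ∃ T : Finset V, (T.card : ℝ) ≤ (2 : ℝ) ^ d ∧
    Metric.closedBall p (2 * r) ⊆ ⋃ t ∈ T, Metric.closedBall t r

/-- The discrete k-means cost of the set `S` of (indices of) centres, for the data points
`x 0, …, x (n - 1)` and the candidate centres `y 0, …, y (m - 1)`: the sum over the data points of
the squared distance to the nearest chosen centre. (`Metric.infDist` is the minimum of the
distances when `S` is finite and nonempty.) -/
noncomputable def cost {V : Type u} [MetricSpace V] {n m : ℕ} (x : Fin n → V) (y : Fin m → V)
    (S : Finset (Fin m)) : ℝ :=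
  ∑ j, Metric.infDist (x j) (y '' (S : Set (Fin m))) ^ 2

/-- `S'` arises from `S` by closing the centres `Q ⊆ S` and opening equally many candidates
`P` outside `S`, where `|P| = |Q| ≤ ρ`. -/
def IsSwap {m : ℕ} (ρ : ℝ) (S S' : Finset (Fin m)) : Prop :=
  ∃ P Q : Finset (Fin m), Disjoint P S ∧ Q ⊆ S ∧ P.card = Q.card ∧ (P.card : ℝ) ≤ ρ ∧
    S' = (S \ Q) ∪ P

/-- No swap of at most `ρ` centres brings the cost of `S` below `(1 - θ) * cost S`. For `θ = 0`
this is local optimality with respect to the `ρ`-swap local search; for `θ = ε / k` it is the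
stopping condition of the variant that only performs substantial improvements. -/
def IsLocalOpt {V : Type u} [MetricSpace V] {n m : ℕ} (x : Fin n → V) (y : Fin m → V)
    (θ ρ : ℝ) (S : Finset (Fin m)) : Prop :=
  ∀ S' : Finset (Fin m), IsSwap ρ S S' → (1 - θ) * cost x y S ≤ cost x y S'

/-- The explicit swap size `32 * d ^ (16 d) * ε ^ (-256 d / ε)`. -/
noncomputable def swapSize (ε d : ℝ) : ℝ :=
  32 * d ^ (16 * d) * ε ^ (-(256 * d / ε))

/-- The swap size `d ^ (c d) * ε ^ (-c d / ε)`. -/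
noncomputable def swapSizeO (c ε d : ℝ) : ℝ :=
  d ^ (c * d) * ε ^ (-(c * d / ε))

/-! ### Step counting -/

/-- A value together with the number of elementary steps spent on computing it. -/
structure Timed (α : Type) where
  val : α
  time : ℕ

instance : Monad Timed where
  pure a := ⟨a, 0⟩
  bind a f := ⟨(f a.val).val, a.time + (f a.val).time⟩

/-- Spend `t` steps. -/
def tick (t : ℕ) : Timed Unit := ⟨(), t⟩

/-! Arithmetic on natural numbers is charged by the binary length of the operands. -/

def addT (a b : ℕ) : Timed ℕ := ⟨a + b, a.size + b.size + 1⟩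

def mulT (a b : ℕ) : Timed ℕ := ⟨a * b, (a.size + 1) * (b.size + 1)⟩

def ltT (a b : ℕ) : Timed Bool := ⟨decide (a < b), a.size + b.size + 1⟩

def minT (a b : ℕ) : Timed ℕ := ⟨min a b, a.size + b.size + 1⟩

/-- The members of `A` that are not in `B`, found by comparing each with all of `B`. -/
def diffT {m : ℕ} (A B : List (Fin m)) : Timed (List (Fin m)) :=
  ⟨A.filter (fun i => i ∉ B), (A.length + 1) * (B.length + 1)⟩

/-- All sublists of length `r`, charged for copying every sublist at every level. -/
def chooseT {α : Type} : ℕ → List α → Timed (List (List α))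
  | 0, _ => do
      tick 1
      pure [[]]
  | _ + 1, [] => do
      tick 1
      pure []
  | r + 1, a :: l => do
      let A ← chooseT r l
      let B ← chooseT (r + 1) l
      tick ((r + 2) * (A.length + B.length) + 1)
      pure (A.map (fun s => a :: s) ++ B)

/-- The first success of `f` along a list. -/
def findT {α β : Type} (f : α → Timed (Option β)) : List α → Timed (Option β)
  | [] => do
      tick 1
      pure none
  | a :: l => do
      tick 1
      match ← f a with
      | some b => pure (some b)
      | none => findT f l

/-- The sum of `f` along a list. -/
def sumT {α : Type} (f : α → Timed ℕ) : List α → Timed ℕ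
  | [] => do
      tick 1
      pure 0
  | a :: l => do
      let v ← f a
      let s ← sumT f l
      addT v s

/-! ### The polynomial-step local search on a matrix of squared distances -/

/-- Total binary length of an input matrix (`w j i` is the squared distance of data point `j` and
candidate centre `i`, in some fixed unit). -/
def inputSize {n m : ℕ} (w : Fin n → Fin m → ℕ) : ℕ :=
  n + m + ∑ j, ∑ i, ((w j i).size + 1)

/-- Read an entry of the input. -/
def readT {n m : ℕ} (w : Fin n → Fin m → ℕ) (j : Fin n) (i : Fin m) : Timed ℕ :=
  ⟨w j i, (w j i).size + 1⟩

/-- Squared distance of `j` to the nearest centre of a nonempty list. -/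
def nearestT {n m : ℕ} (w : Fin n → Fin m → ℕ) (j : Fin n) : List (Fin m) → Timed ℕ
  | [] => do
      tick 1
      pure 0
  | [i] => readT w j i
  | i :: i' :: l => do
      let v ← readT w j i
      let u ← nearestT w j (i' :: l)
      minT v u

/-- Cost of a solution. -/
def costT {n m : ℕ} (w : Fin n → Fin m → ℕ) (S : List (Fin m)) : Timed ℕ := do
  tick n
  sumT (fun j => nearestT w j S) (List.finRange n)

/-- Look for sets `Q ⊆ S`, `P` outside `S` with `|P| = |Q| ≤ ρ` such that
`cost ((S \ Q) ∪ P) < (1 - 1 / (N * k)) * cost S`, where `k = |S|`, by trying all possibilities.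
Returns `(S \ Q) ∪ P` for the first such pair, and `none` if there is none. -/
def improveT {n m : ℕ} (w : Fin n → Fin m → ℕ) (ρ N : ℕ) (S : List (Fin m)) :
    Timed (Option (List (Fin m))) := do
  tick (m + S.length + ρ + 1)
  let M ← mulT N S.length
  let c ← costT w S
  let bound ← mulT (M - 1) c
  let out ← diffT (List.finRange m) S
  findT (fun r => do
    let Qs ← chooseT r S
    let Ps ← chooseT r out
    findT (fun Q =>
      findT (fun P => do
        let kept ← diffT S Q
        tick (kept.length + P.length + 1)
        let S' := kept ++ P
        let c' ← costT w S'
        let scaled ← mulT M c'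
        if ← ltT scaled bound then pure (some S') else pure none) Ps) Qs)
    (List.range (ρ + 1))

/-- `Runs w ρ N S R t`: the local search loop, started from `S`, performs improvements as long as
`improveT` finds one, and halts with the solution `R` after `t` elementary steps in all. -/
inductive Runs {n m : ℕ} (w : Fin n → Fin m → ℕ) (ρ N : ℕ) :
    List (Fin m) → List (Fin m) → ℕ → Prop
  | halt (S : List (Fin m)) (h : (improveT w ρ N S).val = none) :
      Runs w ρ N S S (improveT w ρ N S).time
  | step (S S' R : List (Fin m)) (t : ℕ) (h : (improveT w ρ N S).val = some S')
      (hr : Runs w ρ N S' R t) :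
      Runs w ρ N S R ((improveT w ρ N S).time + t)

end KMeans

open KMeans

namespace KMeans

/-! If `d < 1` the space has at most one point and all costs vanish, so let `1 ≤ d`. Let `S` be a
local optimum and `O` any solution; a client at distance `s` from `S` and `t` from `O` is an edge
from its centre in `S` to its centre in `O`. Label all centres so that each class has equally many
members in `S` and in `O`, boundedly many. A class defines an exchange: close its part of `S`, open
its part of `O`. Local optimality bounds every exchange from below. If, summed over the classes,
each client changes its cost by `t² - s²` up to `O(e) (s² + t²)`, then `cost S ≤ (1 + O(e)) cost O`
follows. A tolerance `e / k` is harmless because there are at most `k` classes.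

A client is in trouble only when its two centres lie in different classes. Keeping certain
nearest-neighbour pairs in one class ensures that every centre of `S` always has an open centre
within three times its distance to `O` (`exists_opened_near`). This fallback is cheap if that
distance, or the distance of the `O`-centre from `S`, is below `e (s + t)`. Otherwise both distances
are comparable to `s + t`, and it suffices that net points near the two centres share a class
(`exists_assignment`). Only clients whose net points are separated incur a large loss.

To separate little weight, scales are grouped into bands at a good shift, and region growing
clusters each band (`exists_setoid_cut_le`, `exists_scaled_clustering`). Doubling bounds the number
of net points in a cluster; centres that do not take part get singleton classes. A zero-sum grouping
of the imbalances merges these into balanced classes of bounded size (`exists_balanced_merging`).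
`exists_labelling` combines this, and `cost_le_of_isLocalOpt` sums up.

For the running time, costs are integers of polynomial length and `N k log cost` drops by at least
one per round until the cost is zero, so there are polynomially many rounds, each trying
polynomially many swaps for a fixed swap size. -/

/-! ### Covering and packing in doubling spaces. -/

/-- Since `2 ^ d < 2` when `d < 1`, one ball of half the radius suffices, and halving repeatedly
forces any two points together. Later estimates can therefore assume `1 ≤ d`, where powers of `d`
grow with the exponent. -/
theorem DoublingDimLE.one_le_or_subsingleton {V : Type u} [MetricSpace V] {d : ℝ}
    (hV : DoublingDimLE V d) : 1 ≤ d ∨ Subsingleton V := by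
  rcases le_or_gt 1 d with h | h
  · exact Or.inl h
  right
  have key : ∀ (p : V) (r : ℝ), 0 < r → ∃ t : V, Metric.closedBall p (2 * r) ⊆
      Metric.closedBall t r := by
    intro p r hr
    obtain ⟨T, hT, hcov⟩ := hV p r hr
    have h2 : (2 : ℝ) ^ d < 2 := by
      calc (2 : ℝ) ^ d < 2 ^ (1 : ℝ) := Real.rpow_lt_rpow_of_exponent_lt (by norm_num) h
        _ = 2 := by norm_num
    have h3 : T.card ≤ 1 := by
      have : (T.card : ℝ) < 2 := lt_of_le_of_lt hT h2
      have : T.card < 2 := by exact_mod_cast this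
      omega
    have hp : p ∈ ⋃ t ∈ T, Metric.closedBall t r := hcov (by simp [hr.le])
    simp only [Set.mem_iUnion] at hp
    obtain ⟨t, ht, -⟩ := hp
    refine ⟨t, fun q hq => ?_⟩
    have := hcov hq
    simp only [Set.mem_iUnion] at this
    obtain ⟨t', ht', hq'⟩ := this
    rwa [Finset.card_le_one.1 h3 t ht t' ht']
  refine ⟨fun p q => ?_⟩
  by_contra hpq
  have hD : 0 < dist p q := dist_pos.2 hpq
  have all : ∀ n : ℕ, ∃ t : V, p ∈ Metric.closedBall t (dist p q / 2 ^ n) ∧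
      q ∈ Metric.closedBall t (dist p q / 2 ^ n) := by
    intro n
    induction n with
    | zero => exact ⟨p, by simp, by simp [dist_comm]⟩
    | succ n ih =>
      obtain ⟨t, h1, h2⟩ := ih
      obtain ⟨t', ht'⟩ := key t (dist p q / 2 ^ (n + 1)) (by positivity)
      have e : 2 * (dist p q / 2 ^ (n + 1)) = dist p q / 2 ^ n := by
        rw [pow_succ]; field_simp
      rw [e] at ht'
      exact ⟨t', ht' h1, ht' h2⟩
  obtain ⟨t, h1, h2⟩ := all 2
  rw [Metric.mem_closedBall] at h1 h2
  have := dist_triangle_right p q t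
  norm_num at h1 h2
  linarith

theorem DoublingDimLE.exists_cover {V : Type u} [MetricSpace V] {d : ℝ}
    (hV : DoublingDimLE V d) (p : V) {R : ℝ} (hR : 0 < R) (n : ℕ) :
    ∃ T : Finset V, (T.card : ℝ) ≤ ((2 : ℝ) ^ d) ^ n ∧
      Metric.closedBall p R ⊆ ⋃ t ∈ T, Metric.closedBall t (R / 2 ^ n) := by
  classical
  induction n with
  | zero => exact ⟨{p}, by simp, by simp⟩
  | succ n ih =>
    obtain ⟨T, hT, hcov⟩ := ih
    have hr : 0 < R / 2 ^ (n + 1) := by positivity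
    choose U hU hUcov using fun t : V => hV t (R / 2 ^ (n + 1)) hr
    refine ⟨T.biUnion U, ?_, fun q hq => ?_⟩
    · calc ((T.biUnion U).card : ℝ) ≤ ∑ t ∈ T, ((U t).card : ℝ) := by
            exact_mod_cast Finset.card_biUnion_le
        _ ≤ ∑ t ∈ T, (2 : ℝ) ^ d := Finset.sum_le_sum fun t _ => hU t
        _ = T.card * (2 : ℝ) ^ d := by simp
        _ ≤ ((2 : ℝ) ^ d) ^ n * (2 : ℝ) ^ d := by gcongr
        _ = _ := (pow_succ _ _).symm
    · have := hcov hq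
      simp only [Set.mem_iUnion] at this
      obtain ⟨t, ht, hqt⟩ := this
      have e : 2 * (R / 2 ^ (n + 1)) = R / 2 ^ n := by
        rw [pow_succ]; field_simp
      rw [← e] at hqt
      have := hUcov t hqt
      simp only [Set.mem_iUnion] at this ⊢
      obtain ⟨t', ht', hq'⟩ := this
      exact ⟨t', Finset.mem_biUnion.2 ⟨t, ht, ht'⟩, hq'⟩

/-- A separated finite family in a ball of a doubling space is small. -/
theorem DoublingDimLE.card_le_of_separated {V : Type u} [MetricSpace V] {d : ℝ}
    (hV : DoublingDimLE V d) (hd : 0 ≤ d) {α : Type*} (A : Finset α) (y : α → V) (p : V)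
    {R r : ℝ} (hr : 0 < r) (hrR : r ≤ R) (hA : ∀ a ∈ A, dist (y a) p ≤ R)
    (hsep : ∀ a ∈ A, ∀ b ∈ A, a ≠ b → r < dist (y a) (y b)) :
    (A.card : ℝ) ≤ (4 * R / r) ^ d := by
  classical
  have hR : 0 < R := hr.trans_le hrR
  have h1 : 1 ≤ 2 * R / r := by rw [le_div_iff₀ hr]; linarith
  -- Balls of radius `R / 2 ^ n ≤ r / 2` contain at most one separated point each; rounding up to a
  -- power of two loses only a factor 2, whence the 4 in the bound.
  obtain ⟨n, hn1, hn2⟩ : ∃ n : ℕ, 2 * R / r ≤ 2 ^ n ∧ (2 : ℝ) ^ n ≤ 4 * R / r := by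
    obtain ⟨n, hn, hn'⟩ := exists_nat_pow_near h1 (by norm_num : (1 : ℝ) < 2)
    refine ⟨n + 1, hn'.le, ?_⟩
    have : 4 * R / r = 2 * (2 * R / r) := by ring
    rw [this, pow_succ]; linarith
  obtain ⟨T, hT, hcov⟩ := hV.exists_cover p hR n
  have hex : ∀ a ∈ A, ∃ t ∈ T, y a ∈ Metric.closedBall t (R / 2 ^ n) := by
    intro a ha
    have := hcov (Metric.mem_closedBall.2 (hA a ha))
    simpa only [Set.mem_iUnion, exists_prop] using this
  have : Nonempty V := ⟨p⟩
  choose! f hfT hf using hex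
  have hcard : A.card ≤ T.card := by
    refine Finset.card_le_card_of_injOn f hfT fun a ha b hb hab => ?_
    by_contra hne
    have h2 := hsep a ha b hb hne
    have h3 := hf a ha
    have h4 := hf b hb
    rw [← hab] at h4
    rw [Metric.mem_closedBall] at h3 h4
    have h5 := dist_triangle_right (y a) (y b) (f a)
    have h6 : 2 * (R / 2 ^ n) ≤ r := by
      have h7 : (0 : ℝ) < 2 ^ n := by positivity
      rw [div_le_iff₀ hr] at hn1
      rw [← mul_div_assoc, div_le_iff₀ h7]
      linarith
    linarith
  calc (A.card : ℝ) ≤ T.card := by exact_mod_cast hcard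
    _ ≤ ((2 : ℝ) ^ d) ^ n := hT
    _ = ((2 : ℝ) ^ n) ^ d := by
      rw [← Real.rpow_natCast, ← Real.rpow_mul (by norm_num), mul_comm,
        Real.rpow_mul (by norm_num), Real.rpow_natCast]
    _ ≤ _ := Real.rpow_le_rpow (by positivity) hn2 hd

/-- A maximal separated subset. -/
theorem exists_net {α : Type*} [DecidableEq α] (S : Finset α) (sep : α → α → Prop)
    (hsymm : ∀ a b, sep a b → sep b a) :
    ∃ N ⊆ S, (∀ a ∈ N, ∀ b ∈ N, a ≠ b → sep a b) ∧
      ∀ a ∈ S, ∃ b ∈ N, b = a ∨ ¬ sep a b := by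
  classical
  obtain ⟨N, hN, hmax⟩ := Finset.exists_max_image
    (S.powerset.filter fun N => ∀ a ∈ N, ∀ b ∈ N, a ≠ b → sep a b) Finset.card
    ⟨∅, by simp⟩
  simp only [Finset.mem_filter, Finset.mem_powerset] at hN hmax
  refine ⟨N, hN.1, hN.2, fun a ha => ?_⟩
  by_contra! hcon
  have haN : a ∉ N := fun h => (hcon a h).1 rfl
  have := hmax (insert a N) ⟨Finset.insert_subset ha hN.1, by
    intro b hb c hc hbc
    rw [Finset.mem_insert] at hb hc
    rcases hb with rfl | hb <;> rcases hc with rfl | hc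
    · exact absurd rfl hbc
    · exact (hcon c hc).2
    · exact hsymm _ _ (hcon b hb).2
    · exact hN.2 b hb c hc hbc⟩
  rw [Finset.card_insert_of_notMem haN] at this
  omega

/-! ### Region growing. -/

/-- Region growing: short weighted edges in a doubling space can be clustered into sets of bounded
radius, so that only a small fraction of the weight is cut. -/
theorem DoublingDimLE.exists_setoid_cut_le {V : Type u} [MetricSpace V] {d : ℝ}
    (hV : DoublingDimLE V d) {ι : Type*} (W : ι → ℝ) (hW : ∀ j, 0 ≤ W j) (u v : ι → V)
    {l e : ℝ} {K : ℕ} (hl : 0 < l) (he : 0 < e) (hK0 : 0 < K) (hK : (2 : ℝ) ^ d ≤ (1 + e) ^ K)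
    (J : Finset ι) (huv : ∀ j ∈ J, dist (u j) (v j) ≤ l) :
    ∃ s : Setoid V, (∀ p, ∃ c, ∀ q, s p q → dist q c ≤ 4 * l * K) ∧
      (open Classical in ∑ j ∈ J with ¬ s (u j) (v j), W j) ≤ e * ∑ j ∈ J, W j := by
  classical
  induction J using Finset.strongInduction with
  | H J ih =>
  have hKpos : (0 : ℝ) < K := by exact_mod_cast hK0
  by_cases h0 : ∀ j ∈ J, W j = 0
  · refine ⟨⊥, fun p => ⟨p, fun q hq => ?_⟩, ?_⟩
    · have : p = q := hq
      rw [this, dist_self]; positivity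
    · rw [Finset.sum_eq_zero (fun j hj => h0 j (Finset.mem_filter.1 hj).1),
        Finset.sum_eq_zero h0, mul_zero]
  push Not at h0
  obtain ⟨j₀, hj₀, hWj₀⟩ := h0
  set G : V → ℝ → ℝ := fun p r => ∑ j ∈ J with dist (u j) p ≤ r, W j with hG
  have Gmono : ∀ p r r', r ≤ r' → G p r ≤ G p r' := by
    intro p r r' h
    refine Finset.sum_le_sum_of_subset_of_nonneg ?_ fun j _ _ => hW j
    exact Finset.monotone_filter_right _ fun j _ hj => le_trans hj h
  -- Exactly `K` shells of width `2 * l` fit between the radii `r₀` and `2 * r₀`.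
  set r₀ : ℝ := 2 * l * K with hr₀
  have hr₀pos : 0 < r₀ := by positivity
  -- A heaviest ball exists because only finitely many subsets of `J` arise. Its maximality turns a
  -- cover of the doubled ball into the growth bound `hdouble`.
  obtain ⟨p, hp⟩ : ∃ p, ∀ q, G q r₀ ≤ G p r₀ := by
    have hfin : (Set.range fun q => J.filter fun j => dist (u j) q ≤ r₀).Finite :=
      (Finset.finite_toSet J.powerset).subset (by
        rintro _ ⟨q, rfl⟩
        exact Finset.mem_coe.2 (Finset.mem_powerset.2 (Finset.filter_subset _ _)))
    obtain ⟨_, ⟨p, rfl⟩, hp⟩ := Set.exists_max_image _ (fun A => ∑ j ∈ A, W j) hfin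
      ⟨_, ⟨u j₀, rfl⟩⟩
    exact ⟨p, fun q => hp _ ⟨q, rfl⟩⟩
  have hpos : 0 < G p r₀ := by
    refine lt_of_lt_of_le ?_ (hp (u j₀))
    refine lt_of_lt_of_le (lt_of_le_of_ne (hW j₀) (Ne.symm hWj₀)) ?_
    exact Finset.single_le_sum (f := W) (fun j _ => hW j)
      (Finset.mem_filter.2 ⟨hj₀, by simp [hr₀pos.le]⟩)
  have hdouble : G p (2 * r₀) ≤ (2 : ℝ) ^ d * G p r₀ := by
    obtain ⟨T, hT, hcov⟩ := hV p r₀ hr₀pos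
    calc G p (2 * r₀) ≤ ∑ j ∈ T.biUnion fun t => J.filter fun j => dist (u j) t ≤ r₀, W j := by
          refine Finset.sum_le_sum_of_subset_of_nonneg (fun j hj => ?_) fun j _ _ => hW j
          rw [Finset.mem_filter] at hj
          have := hcov (Metric.mem_closedBall.2 hj.2)
          simp only [Set.mem_iUnion, exists_prop, Metric.mem_closedBall] at this
          obtain ⟨t, ht, h⟩ := this
          exact Finset.mem_biUnion.2 ⟨t, ht, Finset.mem_filter.2 ⟨hj.1, h⟩⟩
      _ ≤ ∑ t ∈ T, G t r₀ := by
          clear hT hcov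
          induction T using Finset.induction_on with
          | empty => simp
          | insert t T ht ih =>
            rw [Finset.biUnion_insert, Finset.sum_insert ht]
            have h1 := Finset.sum_union_inter (f := W)
              (s₁ := J.filter fun j => dist (u j) t ≤ r₀)
              (s₂ := T.biUnion fun t => J.filter fun j => dist (u j) t ≤ r₀)
            have h2 : 0 ≤ ∑ j ∈ (J.filter fun j => dist (u j) t ≤ r₀) ∩
                (T.biUnion fun t => J.filter fun j => dist (u j) t ≤ r₀), W j :=
              Finset.sum_nonneg fun j _ => hW j
            have h3 : G t r₀ = ∑ j ∈ J with dist (u j) t ≤ r₀, W j := rfl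
            linarith
      _ ≤ ∑ t ∈ T, G p r₀ := Finset.sum_le_sum fun t _ => hp t
      _ = T.card * G p r₀ := by simp
      _ ≤ _ := by gcongr
  -- If every shell raised the weight by a factor above `1 + e`, the doubled ball would weigh more
  -- than `(1 + e) ^ K ≥ 2 ^ d` times the ball.
  obtain ⟨t, htK, ht⟩ : ∃ t < K, G p (r₀ + 2 * l * (t + 1 : ℕ)) ≤
      (1 + e) * G p (r₀ + 2 * l * t) := by
    by_contra! hcon
    have hgrow : ∀ t ≤ K, (1 + e) ^ t * G p r₀ ≤ G p (r₀ + 2 * l * t) := by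
      intro t
      induction t with
      | zero => intro _; simp
      | succ t ih' =>
        intro ht
        have h1 := ih' (by omega)
        have h2 := hcon t (by omega)
        calc (1 + e) ^ (t + 1) * G p r₀ = (1 + e) * ((1 + e) ^ t * G p r₀) := by ring
          _ ≤ (1 + e) * G p (r₀ + 2 * l * t) := by gcongr
          _ ≤ _ := h2.le
    obtain ⟨K', rfl⟩ : ∃ K', K = K' + 1 := ⟨K - 1, by omega⟩
    have h1 := hgrow K' (by omega)
    have h2 := hcon K' (by omega)
    have h3 : r₀ + 2 * l * (K' + 1 : ℕ) = 2 * r₀ := by rw [hr₀]; ring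
    rw [h3] at h2
    have h4 : (2 : ℝ) ^ d * G p r₀ ≤ (1 + e) ^ (K' + 1) * G p r₀ := by gcongr
    have h5 : (1 + e) ^ (K' + 1) * G p r₀ ≤ (1 + e) * G p (r₀ + 2 * l * K') := by
      calc (1 + e) ^ (K' + 1) * G p r₀ = (1 + e) * ((1 + e) ^ K' * G p r₀) := by ring
        _ ≤ _ := by gcongr
    linarith
  -- The sphere runs through the middle of the light shell, so an edge of length at most `l` that
  -- crosses it has `u j` in that shell.
  set r : ℝ := r₀ + 2 * l * t + l with hr
  have hrle : r ≤ 4 * l * K := by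
    have : (t : ℝ) + 1 ≤ K := by exact_mod_cast htK
    have : 2 * l * (t + 1) ≤ 2 * l * K := by gcongr
    rw [hr, hr₀]; linarith
  -- The edges starting in the ball pay for this cut and are dropped, so no weight pays twice.
  set J' : Finset ι := J.filter fun j => ¬ dist (u j) p ≤ r with hJ'
  have hJ'lt : J' ⊂ J := by
    refine Finset.filter_ssubset.2 ?_
    by_contra! hcon
    have : G p r₀ = 0 := by
      refine Finset.sum_eq_zero fun j hj => ?_
      rw [Finset.mem_filter] at hj
      have h1 := hcon j hj.1
      have : r₀ ≤ r := by
        have : 0 ≤ 2 * l * t := by positivity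
        rw [hr]; linarith
      exact absurd (hj.2.trans this) (not_le.2 h1)
    linarith
  obtain ⟨s, hs, hcut⟩ := ih J' hJ'lt fun j hj => huv j (Finset.mem_filter.1 hj).1
  refine ⟨⟨fun a b => (dist a p ≤ r ∧ dist b p ≤ r) ∨
      (¬ dist a p ≤ r ∧ ¬ dist b p ≤ r ∧ s a b), ?_, ?_, ?_⟩, ?_, ?_⟩
  · intro a
    by_cases h : dist a p ≤ r
    · exact Or.inl ⟨h, h⟩
    · exact Or.inr ⟨h, h, s.refl a⟩
  · rintro a b (⟨h1, h2⟩ | ⟨h1, h2, h3⟩)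
    · exact Or.inl ⟨h2, h1⟩
    · exact Or.inr ⟨h2, h1, s.symm h3⟩
  · rintro a b c (⟨h1, h2⟩ | ⟨h1, h2, h3⟩) (⟨h4, h5⟩ | ⟨h4, h5, h6⟩)
    · exact Or.inl ⟨h1, h5⟩
    · exact absurd h2 h4
    · exact absurd h4 h2
    · exact Or.inr ⟨h1, h5, s.trans h3 h6⟩
  · intro a
    by_cases h : dist a p ≤ r
    · refine ⟨p, ?_⟩
      rintro q (⟨-, h2⟩ | ⟨h1, -⟩)
      · exact h2.trans hrle
      · exact absurd h h1
    · obtain ⟨c, hc⟩ := hs a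
      refine ⟨c, ?_⟩
      rintro q (⟨h1, -⟩ | ⟨-, -, h3⟩)
      · exact absurd h1 h
      · exact hc q h3
  · set A : Finset ι := (J.filter fun j => dist (u j) p ≤ r₀ + 2 * l * (t + 1 : ℕ)) \
        (J.filter fun j => dist (u j) p ≤ r₀ + 2 * l * t) with hA
    have hsub : ∀ j ∈ J, ¬ ((dist (u j) p ≤ r ∧ dist (v j) p ≤ r) ∨
        (¬ dist (u j) p ≤ r ∧ ¬ dist (v j) p ≤ r ∧ s (u j) (v j))) →
        j ∈ A ∪ (J'.filter fun j => ¬ s (u j) (v j)) := by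
      intro j hjJ hj
      have hd := huv j hjJ
      have hx1 := dist_triangle (u j) (v j) p
      have hx2 := dist_triangle_left (v j) p (u j)
      have e1 : r₀ + 2 * l * (t + 1 : ℕ) = r + l := by rw [hr]; push_cast; ring
      have e2 : r₀ + 2 * l * t = r - l := by rw [hr]; ring
      simp only [Finset.mem_union, Finset.mem_sdiff, Finset.mem_filter, e1, e2, hJ', hA]
      by_cases h1 : dist (u j) p ≤ r <;> by_cases h2 : dist (v j) p ≤ r
      · exact absurd (Or.inl ⟨h1, h2⟩) hj
      · left
        refine ⟨⟨hjJ, by linarith⟩, fun h => h2 (by linarith [h.2])⟩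
      · left
        refine ⟨⟨hjJ, by linarith⟩, fun h => h1 (by linarith [h.2])⟩
      · right
        exact ⟨⟨hjJ, h1⟩, fun h => hj (Or.inr ⟨h1, h2, h⟩)⟩
    have hsplit : G p r + ∑ j ∈ J', W j = ∑ j ∈ J, W j :=
      Finset.sum_filter_add_sum_filter_not J (fun j => dist (u j) p ≤ r) W
    have hring : ∑ j ∈ A, W j =
        G p (r₀ + 2 * l * (t + 1 : ℕ)) - G p (r₀ + 2 * l * t) := by
      rw [Finset.sum_sdiff_eq_sub]
      refine Finset.monotone_filter_right _ fun j _ hj => le_trans hj ?_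
      push_cast
      nlinarith
    have hGr : G p (r₀ + 2 * l * t) ≤ G p r := Gmono _ _ _ (by rw [hr]; linarith)
    have hunion := Finset.sum_union_inter (f := W) (s₁ := A)
      (s₂ := J'.filter fun j => ¬ s (u j) (v j))
    have hinter : 0 ≤ ∑ j ∈ A ∩ (J'.filter fun j => ¬ s (u j) (v j)), W j :=
      Finset.sum_nonneg fun j _ => hW j
    have hGe : e * G p (r₀ + 2 * l * t) ≤ e * G p r := by gcongr
    refine le_trans (Finset.sum_le_sum_of_subset_of_nonneg (fun j hj =>
      hsub j (Finset.mem_filter.1 hj).1 (Finset.mem_filter.1 hj).2) fun j _ _ => hW j) ?_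
    rw [← hsplit, mul_add]
    linarith

/-! ### Zero-sum families of integers. -/

/-- A zero-sum family of integers bounded by `M` has a nonempty zero-sum subfamily of size at most
`2 * M + 1`. -/
theorem exists_short_zero_sum {α : Type*} [DecidableEq α] (a : α → ℤ) (M : ℕ) (I : Finset α)
    (hne : I.Nonempty) (hM : ∀ i ∈ I, |a i| ≤ M) (h0 : ∑ i ∈ I, a i = 0) :
    ∃ J ⊆ I, J.Nonempty ∧ ∑ i ∈ J, a i = 0 ∧ J.card ≤ 2 * M + 1 := by
  classical
  rcases le_or_gt I.card (2 * M + 1) with hc | hc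
  · exact ⟨I, Finset.Subset.refl _, hne, h0, hc⟩
  -- Partial sums stay in `[-M, M]` if the next element never has the sign of the current sum; one
  -- exists because the remaining elements sum to the negative of it.
  let P : Finset α → Prop := fun J => J ⊆ I ∧ |∑ i ∈ J, a i| ≤ M
  have step : ∀ J, P J → J ≠ I → ∃ i ∈ I, i ∉ J ∧ P (insert i J) := by
    rintro J ⟨hJI, hJ⟩ hne'
    have hss : (I \ J).Nonempty := by
      rw [Finset.sdiff_nonempty]
      exact fun h => hne' (Finset.Subset.antisymm hJI h)
    have hrest : ∑ i ∈ I \ J, a i = -∑ i ∈ J, a i := by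
      have := Finset.sum_sdiff (f := a) hJI
      linarith
    have hex : ∃ i ∈ I \ J, |a i + ∑ i ∈ J, a i| ≤ M := by
      rcases le_or_gt (∑ i ∈ J, a i) 0 with h | h
      · obtain ⟨i, hi, hai⟩ := Finset.exists_le_of_sum_le (f := fun _ => (0 : ℤ)) (g := a) hss
          (by simp [hrest, h])
        refine ⟨i, hi, ?_⟩
        have := hM i (Finset.mem_sdiff.1 hi).1
        rw [abs_le] at *
        constructor <;> linarith
      · obtain ⟨i, hi, hai⟩ := Finset.exists_le_of_sum_le (f := a) (g := fun _ => (0 : ℤ)) hss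
          (by simp [hrest, h.le])
        refine ⟨i, hi, ?_⟩
        have := hM i (Finset.mem_sdiff.1 hi).1
        rw [abs_le] at *
        constructor <;> linarith
    obtain ⟨i, hi, hai⟩ := hex
    rw [Finset.mem_sdiff] at hi
    exact ⟨i, hi.1, hi.2, Finset.insert_subset hi.1 hJI, by rwa [Finset.sum_insert hi.2]⟩
  have : Nonempty α := ⟨hne.choose⟩
  choose! g hgI hgJ hgP using step
  let F : ℕ → Finset α := fun t => Nat.rec ∅ (fun _ J => insert (g J) J) t
  have hF : ∀ t ≤ 2 * M + 1, P (F t) ∧ (F t).card = t := by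
    intro t
    induction t with
    | zero => intro _; exact ⟨⟨Finset.empty_subset _, by simp [F]⟩, by simp [F]⟩
    | succ t ih =>
      intro ht
      obtain ⟨h1, h2⟩ := ih (by omega)
      have hne' : F t ≠ I := fun h => by rw [h] at h2; omega
      refine ⟨hgP _ h1 hne', ?_⟩
      change (insert (g (F t)) (F t)).card = t + 1
      rw [Finset.card_insert_of_notMem (hgJ _ h1 hne'), h2]
  have hmono : ∀ s t, s ≤ t → F s ⊆ F t := by
    intro s t hst
    induction t, hst using Nat.le_induction with
    | base => exact Finset.Subset.refl _
    | succ t _ ih => exact ih.trans (Finset.subset_insert _ _)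
  -- There are `2 * M + 2` prefixes but only `2 * M + 1` possible sums; the elements between two
  -- prefixes of equal sum form the subfamily.
  obtain ⟨s, hs, t, ht, hst, heq⟩ := Finset.exists_ne_map_eq_of_card_lt_of_maps_to
    (s := Finset.range (2 * M + 2)) (t := Finset.Icc (-(M : ℤ)) M)
    (f := fun t => ∑ i ∈ F t, a i) (by simp; omega) (by
      intro t ht
      have ht : t < 2 * M + 2 := by simpa using ht
      have := (hF t (by omega)).1.2
      rw [abs_le] at this
      simpa using this)
  simp only [Finset.mem_range] at hs ht
  have key : ∀ s t, s < t → t ≤ 2 * M + 1 → ∑ i ∈ F s, a i = ∑ i ∈ F t, a i →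
      ∃ J ⊆ I, J.Nonempty ∧ ∑ i ∈ J, a i = 0 ∧ J.card ≤ 2 * M + 1 := by
    intro s t hst ht heq
    have hsub := hmono s t hst.le
    refine ⟨F t \ F s, Finset.sdiff_subset.trans (hF t ht).1.1, ?_, ?_, ?_⟩
    · rw [← Finset.card_pos, Finset.card_sdiff_of_subset hsub, (hF t ht).2,
        (hF s (by omega)).2]
      omega
    · rw [Finset.sum_sdiff_eq_sub hsub, heq, sub_self]
    · rw [Finset.card_sdiff_of_subset hsub, (hF t ht).2]
      omega
  rcases lt_or_gt_of_ne hst with h | h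
  · exact key s t h (by omega) heq
  · exact key t s h (by omega) heq.symm

/-- A zero-sum family of integers bounded by `M` splits into zero-sum families of size at most
`2 * M + 1`. -/
theorem exists_zero_sum_grouping {α : Type*} [DecidableEq α] (a : α → ℤ) (M : ℕ) (I : Finset α)
    (hM : ∀ i ∈ I, |a i| ≤ M) (h0 : ∑ i ∈ I, a i = 0) :
    ∃ h : α → ℕ, ∀ n, ∑ i ∈ I with h i = n, a i = 0 ∧
      (I.filter fun i => h i = n).card ≤ 2 * M + 1 := by
  induction I using Finset.strongInduction with
  | H I ih =>
  rcases I.eq_empty_or_nonempty with rfl | hne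
  · exact ⟨fun _ => 0, by simp⟩
  obtain ⟨J, hJI, hJne, hJ0, hJc⟩ := exists_short_zero_sum a M I hne hM h0
  obtain ⟨h, hh⟩ := ih (I \ J) (Finset.sdiff_ssubset hJI hJne)
    (fun i hi => hM i (Finset.mem_sdiff.1 hi).1)
    (by rw [Finset.sum_sdiff_eq_sub hJI, h0, hJ0, sub_zero])
  refine ⟨fun i => if i ∈ J then 0 else h i + 1, fun n => ?_⟩
  rcases n with _ | n
  · have : (I.filter fun i => (if i ∈ J then 0 else h i + 1) = 0) = J := by
      ext i
      by_cases hi : i ∈ J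
      · simp [hi, hJI hi]
      · simp [hi]
    rw [this]
    exact ⟨hJ0, hJc⟩
  · have : (I.filter fun i => (if i ∈ J then 0 else h i + 1) = n + 1) =
        (I \ J).filter fun i => h i = n := by
      ext i
      by_cases hi : i ∈ J <;> simp [hi]
    rw [this]
    exact hh n

/-! ### Costs and exchanges. -/

section LocalOpt

variable {V : Type u} [MetricSpace V] {n m : ℕ} {x : Fin n → V} {y : Fin m → V}

theorem cost_nonneg (S : Finset (Fin m)) : 0 ≤ cost x y S :=
  Finset.sum_nonneg fun _ _ => sq_nonneg _

theorem cost_le_of_assignment {S : Finset (Fin m)} (c : Fin n → Fin m) (hc : ∀ j, c j ∈ S) :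
    cost x y S ≤ ∑ j, dist (x j) (y (c j)) ^ 2 := by
  refine Finset.sum_le_sum fun j _ => ?_
  have : Metric.infDist (x j) (y '' (S : Set (Fin m))) ≤ dist (x j) (y (c j)) :=
    Metric.infDist_le_dist_of_mem ⟨c j, hc j, rfl⟩
  exact pow_le_pow_left₀ Metric.infDist_nonneg this 2

theorem exists_nearest {S : Finset (Fin m)} (hS : S.Nonempty) (p : V) :
    ∃ i ∈ S, Metric.infDist p (y '' (S : Set (Fin m))) = dist p (y i) ∧
      ∀ a ∈ S, dist p (y i) ≤ dist p (y a) := by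
  obtain ⟨i, hi, hmin⟩ := Finset.exists_min_image S (fun a => dist p (y a)) hS
  refine ⟨i, hi, le_antisymm (Metric.infDist_le_dist_of_mem ⟨i, hi, rfl⟩) ?_, hmin⟩
  rw [Metric.le_infDist (Set.Nonempty.image y ⟨i, hi⟩)]
  rintro _ ⟨a, ha, rfl⟩
  exact hmin a ha

/-- Local optimality against exchanges that may open fewer new centres than they close, and may
re-open centres of `S`. -/
theorem IsLocalOpt.le_of_assignment {θ ρ : ℝ} {S P Q : Finset (Fin m)}
    (hS : IsLocalOpt x y θ ρ S) (hQ : Q ⊆ S) (hPQ : P.card ≤ Q.card) (hP : (P.card : ℝ) ≤ ρ)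
    (c : Fin n → Fin m) (hc : ∀ j, c j ∈ (S \ Q) ∪ P) :
    (1 - θ) * cost x y S ≤ ∑ j, dist (x j) (y (c j)) ^ 2 := by
  -- Centres of `P` already in `S` just stay open, and only as many members of `Q \ P` are closed as
  -- are needed; every centre used by `c` remains available.
  have h1 : (P \ S).card ≤ (Q \ P).card := by
    have h2 := Finset.card_sdiff_add_card_inter P S
    have h3 := Finset.card_sdiff_add_card_inter Q P
    have h4 : (Q ∩ P).card ≤ (P ∩ S).card :=
      Finset.card_le_card fun a ha => by
        rw [Finset.mem_inter] at ha ⊢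
        exact ⟨ha.2, hQ ha.1⟩
    omega
  obtain ⟨Q', hQ', hcard⟩ := Finset.exists_subset_card_eq h1
  refine (hS ((S \ Q') ∪ (P \ S)) ⟨P \ S, Q', Finset.sdiff_disjoint,
    hQ'.trans (Finset.sdiff_subset.trans hQ), hcard.symm, ?_, rfl⟩).trans
    (cost_le_of_assignment c fun j => ?_)
  · have : ((P \ S).card : ℝ) ≤ P.card := by exact_mod_cast Finset.card_le_card Finset.sdiff_subset
    linarith
  · have := hc j
    rw [Finset.mem_union, Finset.mem_sdiff] at this
    rw [Finset.mem_union, Finset.mem_sdiff, Finset.mem_sdiff]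
    by_cases hjS : c j ∈ S
    · left
      refine ⟨hjS, fun h => ?_⟩
      have := Finset.mem_sdiff.1 (hQ' h)
      tauto
    · tauto

end LocalOpt

/-! ### Pairs of centres and the reassignment of a client. -/

/-- Nearest-centre maps between two sets of centres `S` and `O`; `cent i` is a centre of `O`
closest to `i` among those whose nearest centre in `S` is `i`. -/
structure Pairing {V : Type u} [MetricSpace V] {m : ℕ} (y : Fin m → V)
    (S O : Finset (Fin m)) where
  toO : Fin m → Fin m
  toS : Fin m → Fin m
  cent : Fin m → Fin m
  toO_mem : ∀ a, toO a ∈ O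
  toO_le : ∀ a, ∀ b ∈ O, dist (y a) (y (toO a)) ≤ dist (y a) (y b)
  toS_mem : ∀ a, toS a ∈ S
  toS_le : ∀ a, ∀ b ∈ S, dist (y a) (y (toS a)) ≤ dist (y a) (y b)
  cent_mem : ∀ v ∈ O, cent (toS v) ∈ O
  toS_cent : ∀ v ∈ O, toS (cent (toS v)) = toS v
  cent_le : ∀ v ∈ O, dist (y (cent (toS v))) (y (toS v)) ≤ dist (y v) (y (toS v))

theorem exists_pairing {V : Type u} [MetricSpace V] {m : ℕ} (y : Fin m → V)
    {S O : Finset (Fin m)} (hS : S.Nonempty) (hO : O.Nonempty) : Nonempty (Pairing y S O) := by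
  classical
  choose toO h1 h2 h3 using fun a => exists_nearest (y := y) hO (y a)
  choose toS h4 h5 h6 using fun a => exists_nearest (y := y) hS (y a)
  have hc : ∀ i, ∃ c, ∀ v ∈ O, toS v = i → c ∈ O ∧ toS c = i ∧
      dist (y c) (y i) ≤ dist (y v) (y i) := by
    intro i
    by_cases h : (O.filter fun v => toS v = i).Nonempty
    · obtain ⟨c, hc, hmin⟩ := Finset.exists_min_image _ (fun v => dist (y v) (y i)) h
      rw [Finset.mem_filter] at hc
      exact ⟨c, fun v hv hvi => ⟨hc.1, hc.2, hmin v (Finset.mem_filter.2 ⟨hv, hvi⟩)⟩⟩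
    -- No centre of `O` is attached to `i`, so the value of `cent` there is irrelevant.
    · exact ⟨i, fun v hv hvi => absurd ⟨v, Finset.mem_filter.2 ⟨hv, hvi⟩⟩ h⟩
  choose cent hcent using hc
  exact ⟨⟨toO, toS, cent, h1, h3, h4, h6, fun v hv => (hcent _ v hv rfl).1,
    fun v hv => (hcent _ v hv rfl).2.1, fun v hv => (hcent _ v hv rfl).2.2⟩⟩

namespace Pairing

variable {V : Type u} [MetricSpace V] {m : ℕ} {y : Fin m → V} {S O : Finset (Fin m)}
  (A : Pairing y S O)

/-- Distance to the nearest centre of `O`. -/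
noncomputable def distO (i : Fin m) : ℝ := dist (y i) (y (A.toO i))

/-- Distance to the nearest centre of `S`. -/
noncomputable def distS (v : Fin m) : ℝ := dist (y v) (y (A.toS v))

/-- The centre `v` of `O` is to be kept together with its nearest centre in `S`. -/
def Paired (e : ℝ) (v : Fin m) : Prop :=
  v ∈ O ∧ A.cent (A.toS v) = v ∧ e * A.distS v ≤ A.distO (A.toS v)

theorem Paired.eq {A : Pairing y S O} {e : ℝ} {v w : Fin m} (hv : A.Paired e v)
    (hw : A.Paired e w) (h : A.toS v = A.toS w) : v = w := by
  rw [← hv.2.1, ← hw.2.1, h]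

theorem distO_toS_le {v : Fin m} (hv : v ∈ O) : A.distO (A.toS v) ≤ A.distS v := by
  have := A.toO_le (A.toS v) v hv
  rwa [dist_comm _ (y v)] at this

theorem distS_toO_le {i : Fin m} (hi : i ∈ S) : A.distS (A.toO i) ≤ A.distO i := by
  have := A.toS_le (A.toO i) i hi
  rwa [dist_comm _ (y i)] at this

theorem distO_le_add (i j : Fin m) : A.distO i ≤ A.distO j + dist (y i) (y j) := by
  have h1 := A.toO_le i (A.toO j) (A.toO_mem j)
  have h2 := dist_triangle (y i) (y j) (y (A.toO j))
  unfold distO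
  linarith

theorem distS_le_add (i j : Fin m) : A.distS i ≤ A.distS j + dist (y i) (y j) := by
  have h1 := A.toS_le i (A.toS j) (A.toS_mem j)
  have h2 := dist_triangle (y i) (y j) (y (A.toS j))
  unfold distS
  linarith

/-- The centres that are open after the exchange given by the class `l` of the labellings `f` of
`S` and `g` of `O`. -/
def Opened {Λ : Type*} (S O : Finset (Fin m)) (f g : Fin m → Λ) (l : Λ) (c : Fin m) : Prop :=
  (c ∈ S ∧ f c ≠ l) ∨ (c ∈ O ∧ g c = l)

/-- If pairs are kept together, then after each exchange there is an open centre near every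
centre of `S`. -/
theorem exists_opened_near {Λ : Type*} {e : ℝ} (he : 0 < e) (he3 : e ≤ 1 / 3) {f g : Fin m → Λ}
    (hfg : ∀ v, A.Paired e v → g v = f (A.toS v)) (l : Λ) {i : Fin m} (hi : i ∈ S) :
    ∃ c, Opened S O f g l c ∧ dist (y i) (y c) ≤ 3 * A.distO i := by
  classical
  by_contra hcon
  -- Take a counterexample with least `distO`. The centre `a` found below is within `2 * distO i`.
  -- If it is closed together with a partner, the partner is open and adds at most `distO i`. If it
  -- has no partner, `distO a` is at most a third of `distO i`, so by minimality `a` has an open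
  -- centre within `distO i`.
  obtain ⟨i, hi, hmin⟩ := Finset.exists_min_image
    (S.filter fun i => ¬ ∃ c, Opened S O f g l c ∧ dist (y i) (y c) ≤ 3 * A.distO i)
    A.distO ⟨i, Finset.mem_filter.2 ⟨hi, hcon⟩⟩
  rw [Finset.mem_filter] at hi
  obtain ⟨hi, hcon⟩ := hi
  have hD : 0 ≤ A.distO i := dist_nonneg
  set v := A.toO i with hv
  have hvO : v ∈ O := A.toO_mem i
  set a := A.toS v with ha
  have haS : a ∈ S := A.toS_mem v
  have h1 : A.distS v ≤ A.distO i := A.distS_toO_le hi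
  have h2 : dist (y i) (y a) ≤ 2 * A.distO i := by
    have h3 := dist_triangle (y i) (y v) (y a)
    have h4 : dist (y i) (y v) = A.distO i := rfl
    have h5 : dist (y v) (y a) = A.distS v := rfl
    linarith
  by_cases hopen : f a = l
  · by_cases hp : e * A.distS (A.cent a) ≤ A.distO a
    · have hpair : A.Paired e (A.cent a) := by
        refine ⟨A.cent_mem v hvO, ?_, ?_⟩
        · rw [ha, A.toS_cent v hvO]
        · have : A.toS (A.cent a) = a := A.toS_cent v hvO
          rwa [this]
      refine hcon ⟨A.cent a, Or.inr ⟨hpair.1, ?_⟩, ?_⟩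
      · rw [hfg _ hpair, ha, A.toS_cent v hvO, ← ha, hopen]
      · have h3 := dist_triangle (y i) (y a) (y (A.cent a))
        have h4 : dist (y (A.cent a)) (y a) ≤ A.distS v := A.cent_le v hvO
        rw [dist_comm (y a)] at h3
        linarith
    · have h3 : A.distS (A.cent a) ≤ A.distS v := by
        have h4 : A.toS (A.cent a) = a := A.toS_cent v hvO
        have h5 := A.cent_le v hvO
        rw [← ha] at h5
        unfold distS
        rw [h4]
        exact h5
      have h6 : A.distO a < e * A.distO i := by
        have : e * A.distS (A.cent a) ≤ e * A.distO i := by gcongr; linarith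
        linarith
      have h7 : e * A.distO i ≤ 1 / 3 * A.distO i := by gcongr
      by_cases h8 : ∃ c, Opened S O f g l c ∧ dist (y a) (y c) ≤ 3 * A.distO a
      · obtain ⟨c, hc, hdc⟩ := h8
        refine hcon ⟨c, hc, ?_⟩
        have := dist_triangle (y i) (y a) (y c)
        linarith
      · have := hmin a (Finset.mem_filter.2 ⟨haS, h8⟩)
        linarith
  · exact hcon ⟨a, Or.inl ⟨haS, hopen⟩, by linarith⟩

theorem exists_opened_near_right {Λ : Type*} {e : ℝ} (he : 0 < e) (he3 : e ≤ 1 / 3)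
    {f g : Fin m → Λ} (hfg : ∀ v, A.Paired e v → g v = f (A.toS v)) (l : Λ) {v : Fin m}
    (hv : v ∈ O) :
    ∃ c, Opened S O f g l c ∧ dist (y v) (y c) ≤ 4 * A.distS v := by
  obtain ⟨c, hc, hdc⟩ := A.exists_opened_near he he3 hfg l (A.toS_mem v)
  refine ⟨c, hc, ?_⟩
  have h1 := dist_triangle (y v) (y (A.toS v)) (y c)
  have h2 := A.distO_toS_le hv
  have h3 : dist (y v) (y (A.toS v)) = A.distS v := rfl
  linarith

/-- The exchanges given by all classes change the cost of a client by at most its gain in moving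
from `i` to `v`, up to a small error, unless the representatives of `i` and `v` are in different
classes. -/
theorem exists_assignment {Λ : Type*} [DecidableEq Λ] {e : ℝ} (he : 0 < e) (he3 : e ≤ 1 / 3)
    {f g : Fin m → Λ} (hfg : ∀ v, A.Paired e v → g v = f (A.toS v)) (I : Finset Λ) (p : V)
    {i v i' v' : Fin m} (hi : i ∈ S) (hv : v ∈ O) (hfi : f i ∈ I) (hgv : g v ∈ I)
    (hi' : i' ∈ S) (hii' : dist (y i) (y i') ≤ e * A.distO i)
    (hv' : v' ∈ O) (hvv' : dist (y v) (y v') ≤ e * A.distS v)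
    {b : ℝ} (hb0 : 0 ≤ b)
    (hb : e * (dist p (y i) + dist p (y v)) < A.distO i →
      e * (dist p (y i) + dist p (y v)) < A.distS v → f i' ≠ g v' →
      dist p (y i) ^ 2 + dist p (y v) ^ 2 ≤ b) :
    ∃ c : Λ → Fin m, (∀ l, Opened S O f g l (c l)) ∧
      ∑ l ∈ I, (dist p (y (c l)) ^ 2 - dist p (y i) ^ 2) ≤
        dist p (y v) ^ 2 - dist p (y i) ^ 2 +
          48 * e * (dist p (y i) ^ 2 + dist p (y v) ^ 2) + 32 * b := by
  set s := dist p (y i) with hs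
  set t := dist p (y v) with ht
  have hs0 : 0 ≤ s := dist_nonneg
  have ht0 : 0 ≤ t := dist_nonneg
  have hiv : dist (y i) (y v) ≤ s + t := dist_triangle_left _ _ _
  have hDi : A.distO i ≤ s + t := (A.toO_le i v hv).trans hiv
  have hEv : A.distS v ≤ s + t := by
    refine (A.toS_le v i hi).trans ?_
    rwa [dist_comm]
  have herr : 0 ≤ 48 * e * (s ^ 2 + t ^ 2) := by positivity
  by_cases hab : f i = g v
  · refine ⟨fun l => if l = g v then v else i, fun l => ?_, ?_⟩
    · dsimp only
      split_ifs with h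
      · exact Or.inr ⟨hv, h.symm⟩
      · exact Or.inl ⟨hi, fun h' => h (h' ▸ hab)⟩
    · rw [Finset.sum_eq_single_of_mem (g v) hgv (by
        intro l _ hl
        dsimp only
        rw [if_neg hl, ← hs, sub_self])]
      dsimp only
      rw [if_pos rfl, ← ht]
      linarith
  -- A client that stays at `i` in all other classes contributes only in the class closing `i` and
  -- the class opening `v`.
  have hsum : ∀ c : Λ → Fin m, (∀ l, l ≠ f i → l ≠ g v → c l = i) →
      ∑ l ∈ I, (dist p (y (c l)) ^ 2 - s ^ 2) =
        (dist p (y (c (f i))) ^ 2 - s ^ 2) + (dist p (y (c (g v))) ^ 2 - s ^ 2) := by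
    intro c hc
    rw [← Finset.sum_pair (f := fun l => dist p (y (c l)) ^ 2 - s ^ 2) hab]
    symm
    refine Finset.sum_subset (Finset.insert_subset hfi (Finset.singleton_subset_iff.2 hgv)) ?_
    intro l _ hl
    simp only [Finset.mem_insert, Finset.mem_singleton, not_or] at hl
    rw [hc l hl.1 hl.2, ← hs, sub_self]
  have hsq : (s + t) ^ 2 ≤ 2 * (s ^ 2 + t ^ 2) := by nlinarith [sq_nonneg (s - t)]
  -- Expanding the square gives an error of at most `(8 + 16) * e * (s + t) ^ 2`, and `(s + t) ^ 2 ≤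
  -- 2 * (s ^ 2 + t ^ 2)` makes it 48.
  have hsmall : ∀ a q : ℝ, 0 ≤ q → 0 ≤ a → a ≤ s + t → q ≤ a + 4 * e * (s + t) →
      q ^ 2 ≤ a ^ 2 + 48 * e * (s ^ 2 + t ^ 2) := by
    intro a q hq ha hast hqa
    have h1 : q ^ 2 ≤ (a + 4 * e * (s + t)) ^ 2 := pow_le_pow_left₀ hq hqa 2
    have h2 : (a + 4 * e * (s + t)) ^ 2 = a ^ 2 + 8 * e * (a * (s + t)) +
      16 * e * (e * (s + t) ^ 2) := by ring
    have h3 : a * (s + t) ≤ (s + t) * (s + t) := by gcongr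
    have h4 : e * (s + t) ^ 2 ≤ 1 * (s + t) ^ 2 := by gcongr; linarith
    have h5 : 8 * e * (a * (s + t)) ≤ 8 * e * ((s + t) * (s + t)) := by gcongr
    have h6 : 16 * e * (e * (s + t) ^ 2) ≤ 16 * e * (1 * (s + t) ^ 2) := by gcongr
    have h7 : 24 * e * (s + t) ^ 2 ≤ 24 * e * (2 * (s ^ 2 + t ^ 2)) := by gcongr
    nlinarith
  -- A fallback about as good as `i`: nothing is lost when `i` closes, and the gain is collected
  -- when `v` opens.
  have caseA : ∀ (c₀ : Fin m) (r : ℝ), Opened S O f g (f i) c₀ → dist p (y c₀) ^ 2 ≤ s ^ 2 + r →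
      ∃ c : Λ → Fin m, (∀ l, Opened S O f g l (c l)) ∧
        ∑ l ∈ I, (dist p (y (c l)) ^ 2 - s ^ 2) ≤ t ^ 2 - s ^ 2 + r := by
    intro c₀ r hc₀ hr
    refine ⟨fun l => if l = f i then c₀ else if l = g v then v else i, fun l => ?_, ?_⟩
    · dsimp only
      split_ifs with h h'
      · rwa [h]
      · exact Or.inr ⟨hv, h'.symm⟩
      · exact Or.inl ⟨hi, Ne.symm h⟩
    · rw [hsum _ fun l h1 h2 => by simp [h1, h2]]
      rw [if_pos rfl, if_neg (Ne.symm hab), if_pos rfl]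
      linarith
  -- A fallback about as good as `v`: the gain is collected already when `i` closes, and the client
  -- ignores the opening of `v`.
  have caseB : ∀ (c₀ : Fin m) (r : ℝ), Opened S O f g (f i) c₀ → dist p (y c₀) ^ 2 ≤ t ^ 2 + r →
      ∃ c : Λ → Fin m, (∀ l, Opened S O f g l (c l)) ∧
        ∑ l ∈ I, (dist p (y (c l)) ^ 2 - s ^ 2) ≤ t ^ 2 - s ^ 2 + r := by
    intro c₀ r hc₀ hr
    refine ⟨fun l => if l = f i then c₀ else i, fun l => ?_, ?_⟩
    · dsimp only
      split_ifs with h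
      · rwa [h]
      · exact Or.inl ⟨hi, Ne.symm h⟩
    · rw [hsum _ fun l h1 h2 => by simp [h1]]
      rw [if_pos rfl, if_neg (Ne.symm hab), ← hs]
      linarith
  suffices ∃ c : Λ → Fin m, (∀ l, Opened S O f g l (c l)) ∧
      (∑ l ∈ I, (dist p (y (c l)) ^ 2 - s ^ 2) ≤
        t ^ 2 - s ^ 2 + 48 * e * (s ^ 2 + t ^ 2) ∨
       ∑ l ∈ I, (dist p (y (c l)) ^ 2 - s ^ 2) ≤ t ^ 2 - s ^ 2 + 32 * b) by
    obtain ⟨c, hc, h | h⟩ := this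
    · exact ⟨c, hc, by linarith⟩
    · exact ⟨c, hc, by linarith⟩
  by_cases hD : A.distO i ≤ e * (s + t)
  · obtain ⟨c₀, hc₀, hdc⟩ := A.exists_opened_near he he3 hfg (f i) hi
    obtain ⟨c, hc, h⟩ := caseA c₀ _ hc₀ (hsmall s _ dist_nonneg hs0 (by linarith) (by
      have := dist_triangle p (y i) (y c₀)
      have : 0 ≤ A.distO i := dist_nonneg
      nlinarith))
    exact ⟨c, hc, Or.inl h⟩
  by_cases hE : A.distS v ≤ e * (s + t)
  · obtain ⟨c₀, hc₀, hdc⟩ := A.exists_opened_near_right he he3 hfg (f i) hv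
    obtain ⟨c, hc, h⟩ := caseB c₀ _ hc₀ (hsmall t _ dist_nonneg ht0 (by linarith) (by
      have := dist_triangle p (y v) (y c₀)
      nlinarith))
    exact ⟨c, hc, Or.inl h⟩
  rw [not_le] at hD hE
  by_cases hsep : f i' = g v'
  -- When the representatives share a class, the exchange that closes `i` either opens `v'` or
  -- leaves `i'` open.
  · by_cases hopen : f i' = f i
    · have h1 : e * A.distS v ≤ e * (s + t) := by gcongr
      obtain ⟨c, hc, h⟩ := caseB v' _ (Or.inr ⟨hv', hsep ▸ hopen⟩)
        (hsmall t _ dist_nonneg ht0 (by linarith) (by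
          have := dist_triangle p (y v) (y v')
          have : 0 ≤ e * (s + t) := by positivity
          linarith))
      exact ⟨c, hc, Or.inl h⟩
    · have h1 : e * A.distO i ≤ e * (s + t) := by gcongr
      obtain ⟨c, hc, h⟩ := caseA i' _ (Or.inl ⟨hi', hopen⟩)
        (hsmall s _ dist_nonneg hs0 (by linarith) (by
          have := dist_triangle p (y i) (y i')
          have : 0 ≤ e * (s + t) := by positivity
          linarith))
      exact ⟨c, hc, Or.inl h⟩
  -- For separated representatives the fallback is within `4 * (s + t)`, and `16 * (s + t) ^ 2 ≤ 32
  -- * (s ^ 2 + t ^ 2)` is charged to `b`.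
  · obtain ⟨c₀, hc₀, hdc⟩ := A.exists_opened_near he he3 hfg (f i) hi
    obtain ⟨c, hc, h⟩ := caseA c₀ (32 * b) hc₀ (by
      have h1 := dist_triangle p (y i) (y c₀)
      have h2 : dist p (y c₀) ≤ 4 * (s + t) := by linarith
      have h3 : dist p (y c₀) ^ 2 ≤ (4 * (s + t)) ^ 2 := pow_le_pow_left₀ dist_nonneg h2 2
      have h4 := hb hD hE hsep
      nlinarith)
    exact ⟨c, hc, Or.inr h⟩

end Pairing

/-! ### Shifted bands of scales and clustering within bands. -/

/-- Few of the `L` shifts of the partition of `ℤ` into blocks of length `L` separate two given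
integers. -/
theorem card_shift_separating_le {L : ℕ} (hL : 0 < L) (a b : ℤ) (k : ℕ) (h : |a - b| ≤ k) :
    ((Finset.range L).filter fun o : ℕ => (a + o) / (L : ℤ) ≠ (b + o) / (L : ℤ)).card ≤ k := by
  have hLz : (L : ℤ) ≠ 0 := by exact_mod_cast hL.ne'
  have hLp : (0 : ℤ) < L := by exact_mod_cast hL
  -- Moving `a` by one slides a window of `L` consecutive integers, so the sum of block indices over
  -- all shifts grows by exactly one. Each separating shift contributes at least one to the total
  -- growth.
  have hstep : ∀ a : ℤ, ∑ o ∈ Finset.range L, (a + 1 + (o : ℤ)) / (L : ℤ) =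
      ∑ o ∈ Finset.range L, (a + (o : ℤ)) / (L : ℤ) + 1 := by
    intro a
    have h1 := Finset.sum_range_succ (fun o : ℕ => (a + (o : ℤ)) / (L : ℤ)) L
    have h2 := Finset.sum_range_succ' (fun o : ℕ => (a + (o : ℤ)) / (L : ℤ)) L
    have h3 : (a + (L : ℤ)) / (L : ℤ) = a / L + 1 := by
      rw [Int.add_ediv_of_dvd_right (dvd_refl _), Int.ediv_self hLz]
    have h4 : ∑ o ∈ Finset.range L, (a + ((o + 1 : ℕ) : ℤ)) / (L : ℤ) =
        ∑ o ∈ Finset.range L, (a + 1 + (o : ℤ)) / (L : ℤ) :=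
      Finset.sum_congr rfl fun o _ => by push_cast; ring_nf
    rw [h3] at h1
    rw [h4] at h2
    simp only [Nat.cast_zero, add_zero] at h2
    linarith
  have hshift : ∀ (c : ℕ) (a : ℤ), ∑ o ∈ Finset.range L, (a + c + (o : ℤ)) / (L : ℤ) =
      ∑ o ∈ Finset.range L, (a + (o : ℤ)) / (L : ℤ) + c := by
    intro c a
    induction c with
    | zero => simp
    | succ c ih =>
      have := hstep (a + c)
      push_cast
      rw [← add_assoc, this, ih]
      ring
  have key : ∀ (a : ℤ) (c : ℕ), ((Finset.range L).filter fun o : ℕ =>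
      (a + o) / (L : ℤ) ≠ (a + c + o) / (L : ℤ)).card ≤ c := by
    intro a c
    have h1 : (((Finset.range L).filter fun o : ℕ =>
        (a + o) / (L : ℤ) ≠ (a + c + o) / (L : ℤ)).card : ℤ) ≤
        ∑ o ∈ Finset.range L, ((a + c + (o : ℤ)) / (L : ℤ) - (a + (o : ℤ)) / (L : ℤ)) := by
      rw [Finset.card_filter]
      push_cast
      refine Finset.sum_le_sum fun o _ => ?_
      have : (a + (o : ℤ)) / (L : ℤ) ≤ (a + c + (o : ℤ)) / (L : ℤ) :=
        Int.ediv_le_ediv hLp (by omega)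
      split_ifs with h <;> omega
    rw [Finset.sum_sub_distrib, hshift] at h1
    omega
  rcases le_total a b with hab | hab
  · obtain ⟨c, hc⟩ := Int.eq_ofNat_of_zero_le (sub_nonneg.2 hab)
    have hb : b = a + c := by omega
    subst hb
    have : c ≤ k := by rw [abs_le] at h; omega
    exact (key a c).trans this
  · obtain ⟨c, hc⟩ := Int.eq_ofNat_of_zero_le (sub_nonneg.2 hab)
    have hb : a = b + c := by omega
    subst hb
    have : c ≤ k := by rw [abs_le] at h; omega
    refine le_trans (le_of_eq ?_) ((key b c).trans this)
    congr 1
    ext o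
    simp only [Finset.mem_filter, ne_comm]

/-- Some shift of the blocks separates little of the weight. -/
theorem exists_shift {ι : Type*} (J : Finset ι) (W : ι → ℝ) (hW : ∀ j, 0 ≤ W j) (a b : ι → ℤ)
    (k : ℕ) (h : ∀ j ∈ J, |a j - b j| ≤ k) {L : ℕ} (hL : 0 < L) :
    ∃ o : ℤ, L * ∑ j ∈ J with (a j + o) / (L : ℤ) ≠ (b j + o) / (L : ℤ), W j ≤
      k * ∑ j ∈ J, W j := by
  classical
  have hsum : ∑ o ∈ Finset.range L, ∑ j ∈ J with
      (a j + (o : ℤ)) / (L : ℤ) ≠ (b j + (o : ℤ)) / (L : ℤ), W j ≤ k * ∑ j ∈ J, W j := by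
    simp_rw [Finset.sum_filter]
    rw [Finset.sum_comm, Finset.mul_sum]
    refine Finset.sum_le_sum fun j hj => ?_
    rw [← Finset.sum_filter, Finset.sum_const, nsmul_eq_mul]
    have := card_shift_separating_le hL (a j) (b j) k (h j hj)
    have h2 : (((Finset.range L).filter fun o : ℕ =>
      (a j + o) / (L : ℤ) ≠ (b j + o) / (L : ℤ)).card : ℝ) ≤ k := by exact_mod_cast this
    exact mul_le_mul_of_nonneg_right h2 (hW j)
  by_contra! hcon
  have h1 : ∑ o ∈ Finset.range L, k * ∑ j ∈ J, W j < ∑ o ∈ Finset.range L,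
      (L : ℝ) * ∑ j ∈ J with (a j + (o : ℤ)) / (L : ℤ) ≠ (b j + (o : ℤ)) / (L : ℤ), W j :=
    Finset.sum_lt_sum_of_nonempty (by simpa using hL.ne') fun o _ => hcon o
  rw [Finset.sum_const, Finset.card_range, nsmul_eq_mul, ← Finset.mul_sum] at h1
  have hLp : (0 : ℝ) < L := by exact_mod_cast hL
  have := lt_of_mul_lt_mul_left h1 hLp.le
  linarith

/-- Clustering of points with scales: edges between points of comparable scale, of length
comparable to the scale, are cut only for a small fraction of the weight. -/
theorem DoublingDimLE.exists_scaled_clustering {V : Type u} [MetricSpace V] {d : ℝ}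
    (hV : DoublingDimLE V d) {X ι : Type*} (loc : X → V) (scale : X → ℝ) (W : ι → ℝ)
    (hW : ∀ j, 0 ≤ W j) (z z' : ι → X) (J : Finset ι) {e : ℝ} (he : 0 < e) (he1 : e < 1)
    {K L : ℕ} (hK0 : 0 < K) (hK : (2 : ℝ) ^ d ≤ (1 + e) ^ K) (hL : e⁻¹ ≤ L)
    (hz : ∀ j ∈ J, 0 < scale (z j)) (hz' : ∀ j ∈ J, 0 < scale (z' j))
    (hzz' : ∀ j ∈ J, scale (z j) ≤ e⁻¹ ^ 3 * scale (z' j))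
    (hz'z : ∀ j ∈ J, scale (z' j) ≤ e⁻¹ ^ 3 * scale (z j))
    (hdist : ∀ j ∈ J, dist (loc (z j)) (loc (z' j)) ≤ e⁻¹ ^ 2 * scale (z j)) :
    ∃ (band : X → ℤ) (lo : ℤ → ℝ) (s : ℤ → Setoid V), (∀ b, 0 < lo b) ∧
      (∀ a, 0 < scale a → lo (band a) ≤ scale a ∧ scale a ≤ lo (band a) * e⁻¹ ^ L) ∧
      (∀ b p, ∃ c, ∀ q, s b p q → dist q c ≤ 4 * (e⁻¹ ^ (L + 2) * lo b) * K) ∧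
      (open Classical in ∑ j ∈ J with ¬ (band (z j) = band (z' j) ∧
        s (band (z j)) (loc (z j)) (loc (z' j))), W j) ≤ 4 * e * ∑ j ∈ J, W j := by
  classical
  set B : ℝ := e⁻¹ with hB
  have hB1 : 1 < B := (one_lt_inv₀ he).2 he1
  have hB0 : 0 < B := by linarith
  have hLpos : 0 < L := by
    have : (0 : ℝ) < L := by linarith
    exact_mod_cast this
  have hLz : (0 : ℤ) < L := by exact_mod_cast hLpos
  -- The level is the integer part of the logarithm to base `e⁻¹`. Points without positive scale get
  -- a default; they are endpoints of no edge in `J`.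
  have hlevel : ∀ a, ∃ t : ℤ, 0 < scale a → B ^ t ≤ scale a ∧ scale a < B ^ (t + 1) := by
    intro a
    by_cases ha : 0 < scale a
    · obtain ⟨t, ht⟩ := exists_mem_Ico_zpow ha hB1
      exact ⟨t, fun _ => ht⟩
    · exact ⟨0, fun h => absurd h ha⟩
  choose level hlevel using hlevel
  have hcomp : ∀ a b, 0 < scale a → 0 < scale b → scale a ≤ B ^ 3 * scale b →
      level a ≤ level b + 3 := by
    intro a b ha hb hab
    have h1 := (hlevel a ha).1
    have h2 := (hlevel b hb).2
    have h3 : B ^ level a < B ^ (level b + 1 + 3) := by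
      calc B ^ level a ≤ B ^ 3 * scale b := h1.trans hab
        _ < B ^ 3 * B ^ (level b + 1) := by gcongr
        _ = B ^ (level b + 1 + 3) := by
          rw [zpow_add₀ hB0.ne' (level b + 1) 3, mul_comm]; norm_cast
    have := (zpow_lt_zpow_iff_right₀ hB1).1 h3
    omega
  -- Endpoints differ by at most 3 levels and `L ≥ e⁻¹`, so a good shift loses at most `3 * e` of
  -- the weight; clustering the bands loses another `e`.
  obtain ⟨o, ho⟩ := exists_shift J W hW (fun j => level (z j)) (fun j => level (z' j)) 3
    (fun j hj => by
      have h1 := hcomp _ _ (hz j hj) (hz' j hj) (hzz' j hj)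
      have h2 := hcomp _ _ (hz' j hj) (hz j hj) (hz'z j hj)
      rw [abs_le]
      constructor <;> push_cast <;> omega) hLpos
  set band : X → ℤ := fun a => (level a + o) / (L : ℤ) with hband
  set lo : ℤ → ℝ := fun b => B ^ (b * L - o) with hlo
  have hlo0 : ∀ b, 0 < lo b := fun b => zpow_pos hB0 _
  have hscale : ∀ a, 0 < scale a → lo (band a) ≤ scale a ∧ scale a ≤ lo (band a) * B ^ L := by
    intro a ha
    obtain ⟨h1, h2⟩ := hlevel a ha
    have h3 : band a * L ≤ level a + o := Int.ediv_mul_le _ hLz.ne'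
    have h4 : level a + o < (band a + 1) * L := Int.lt_ediv_add_one_mul_self _ hLz
    refine ⟨le_trans ?_ h1, h2.le.trans ?_⟩
    · exact zpow_le_zpow_right₀ hB1.le (by omega)
    · rw [hlo, ← zpow_natCast, ← zpow_add₀ hB0.ne']
      refine zpow_le_zpow_right₀ hB1.le ?_
      have : (band a + 1) * L = band a * L + L := by ring
      omega
  let Jb : ℤ → Finset ι := fun b => J.filter fun j => band (z j) = b ∧ band (z' j) = b
  have hs : ∀ b, ∃ s : Setoid V, (∀ p, ∃ c, ∀ q, s p q → dist q c ≤ 4 * (B ^ (L + 2) * lo b) * K) ∧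
      (∑ j ∈ Jb b with ¬ s (loc (z j)) (loc (z' j)), W j) ≤ e * ∑ j ∈ Jb b, W j := by
    intro b
    -- Scales in band `b` are at most `lo b * B ^ L`, and an edge is at most `B ^ 2` times its
    -- scale.
    have := hV.exists_setoid_cut_le W hW (fun j => loc (z j)) (fun j => loc (z' j))
      (l := B ^ (L + 2) * lo b) (by have := hlo0 b; positivity) he hK0 hK (Jb b) (by
        intro j hj
        obtain ⟨hjJ, hb1, hb2⟩ := Finset.mem_filter.1 hj
        refine (hdist j hjJ).trans ?_
        have := (hscale _ (hz j hjJ)).2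
        rw [hb1] at this
        calc B ^ 2 * scale (z j) ≤ B ^ 2 * (lo b * B ^ L) := by gcongr
          _ = _ := by ring)
    obtain ⟨s, h1, h2⟩ := this
    refine ⟨s, h1, le_trans (le_of_eq ?_) h2⟩
    congr!
  choose s hs1 hs2 using hs
  refine ⟨band, lo, s, hlo0, hscale, hs1, ?_⟩
  have hcut1 : ∑ j ∈ J with band (z j) ≠ band (z' j), W j ≤ 3 * e * ∑ j ∈ J, W j := by
    have h1 : 1 ≤ e * L := by
      calc (1 : ℝ) = e * B := (mul_inv_cancel₀ he.ne').symm
        _ ≤ e * L := by gcongr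
    have h2 : 0 ≤ ∑ j ∈ J with band (z j) ≠ band (z' j), W j :=
      Finset.sum_nonneg fun j _ => hW j
    have h3 : (L : ℝ) * ∑ j ∈ J with band (z j) ≠ band (z' j), W j ≤ 3 * ∑ j ∈ J, W j := by
      exact_mod_cast ho
    calc _ ≤ (e * L) * ∑ j ∈ J with band (z j) ≠ band (z' j), W j :=
          le_mul_of_one_le_left h2 h1
      _ = e * (L * ∑ j ∈ J with band (z j) ≠ band (z' j), W j) := by ring
      _ ≤ e * (3 * ∑ j ∈ J, W j) := by gcongr
      _ = _ := by ring
  set T : Finset ℤ := J.image fun j => band (z j) with hT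
  have hdisj : Set.PairwiseDisjoint (T : Set ℤ) Jb := by
    intro b _ b' _ hbb'
    rw [Function.onFun, Finset.disjoint_left]
    intro j hj hj'
    exact hbb' ((Finset.mem_filter.1 hj).2.1.symm.trans (Finset.mem_filter.1 hj').2.1)
  have hcut2 : ∑ b ∈ T, ∑ j ∈ Jb b with ¬ s b (loc (z j)) (loc (z' j)), W j ≤
      e * ∑ j ∈ J, W j := by
    calc _ ≤ ∑ b ∈ T, e * ∑ j ∈ Jb b, W j := Finset.sum_le_sum fun b _ => hs2 b
      _ = e * ∑ j ∈ T.biUnion Jb, W j := by rw [← Finset.mul_sum, Finset.sum_biUnion hdisj]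
      _ ≤ _ := by
        refine mul_le_mul_of_nonneg_left ?_ he.le
        refine Finset.sum_le_sum_of_subset_of_nonneg (fun j hj => ?_) fun j _ _ => hW j
        obtain ⟨b, -, hj⟩ := Finset.mem_biUnion.1 hj
        exact (Finset.mem_filter.1 hj).1
  have hcut2' : ∑ j ∈ T.biUnion (fun b => (Jb b).filter fun j =>
      ¬ s b (loc (z j)) (loc (z' j))), W j ≤ e * ∑ j ∈ J, W j := by
    rw [Finset.sum_biUnion]
    · exact hcut2
    · intro b hb b' hb' hbb'
      exact (hdisj hb hb' hbb').mono (Finset.filter_subset _ _) (Finset.filter_subset _ _)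
  have hunion := Finset.sum_union_inter (f := W)
    (s₁ := J.filter fun j => band (z j) ≠ band (z' j))
    (s₂ := T.biUnion (fun b => (Jb b).filter fun j => ¬ s b (loc (z j)) (loc (z' j))))
  have hinter : 0 ≤ ∑ j ∈ (J.filter fun j => band (z j) ≠ band (z' j)) ∩
      (T.biUnion (fun b => (Jb b).filter fun j => ¬ s b (loc (z j)) (loc (z' j)))), W j :=
    Finset.sum_nonneg fun j _ => hW j
  refine le_trans (Finset.sum_le_sum_of_subset_of_nonneg (t :=
    (J.filter fun j => band (z j) ≠ band (z' j)) ∪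
      (T.biUnion (fun b => (Jb b).filter fun j => ¬ s b (loc (z j)) (loc (z' j)))))
    (fun j hj => ?_) fun j _ _ => hW j) (by linarith)
  rw [Finset.mem_filter] at hj
  rw [Finset.mem_union, Finset.mem_filter]
  by_cases hb : band (z j) = band (z' j)
  · right
    refine Finset.mem_biUnion.2 ⟨band (z j), Finset.mem_image_of_mem _ hj.1, ?_⟩
    exact Finset.mem_filter.2 ⟨Finset.mem_filter.2 ⟨hj.1, rfl, hb.symm⟩, fun h => hj.2 ⟨hb, h⟩⟩
  · exact Or.inl ⟨hj.1, hb⟩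

/-! ### Balanced classes and bounds on their size. -/

/-- Classes of bounded size can be merged into balanced classes of bounded size. -/
theorem exists_balanced_merging {α Λ : Type*} [DecidableEq Λ] (S O : Finset α) (f g : α → Λ)
    (M : ℕ) (hcard : S.card = O.card) (hf : ∀ l, (S.filter fun i => f i = l).card ≤ M)
    (hg : ∀ l, (O.filter fun i => g i = l).card ≤ M) :
    ∃ h : Λ → ℕ, ∀ n, (S.filter fun i => h (f i) = n).card = (O.filter fun i => h (g i) = n).card ∧
      (O.filter fun i => h (g i) = n).card ≤ (2 * M + 1) * M := by
  classical
  set a : Λ → ℤ := fun l =>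
    ((S.filter fun i => f i = l).card : ℤ) - ((O.filter fun i => g i = l).card : ℤ) with ha
  set I : Finset Λ := S.image f ∪ O.image g with hI
  have hSI : ∀ i ∈ S, f i ∈ I := fun i hi =>
    Finset.mem_union_left _ (Finset.mem_image_of_mem _ hi)
  have hOI : ∀ i ∈ O, g i ∈ I := fun i hi =>
    Finset.mem_union_right _ (Finset.mem_image_of_mem _ hi)
  have h0 : ∑ l ∈ I, a l = 0 := by
    rw [ha, Finset.sum_sub_distrib]
    have h1 := Finset.card_eq_sum_card_fiberwise (f := f) (s := S) (t := I) hSI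
    have h2 := Finset.card_eq_sum_card_fiberwise (f := g) (s := O) (t := I) hOI
    have h1' : (S.card : ℤ) = ∑ l ∈ I, ((S.filter fun i => f i = l).card : ℤ) := by
      exact_mod_cast h1
    have h2' : (O.card : ℤ) = ∑ l ∈ I, ((O.filter fun i => g i = l).card : ℤ) := by
      exact_mod_cast h2
    rw [← h1', ← h2', hcard, sub_self]
  -- The imbalances lie in `[-M, M]` and sum to zero because `S` and `O` are equally large; each
  -- zero-sum group of classes becomes one class.
  obtain ⟨h, hh⟩ := exists_zero_sum_grouping a M I (fun l _ => by
    have h1 := hf l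
    have h2 := hg l
    rw [ha, abs_le]
    constructor <;> dsimp only <;> omega) h0
  have hfib : ∀ (U : Finset α) (q : α → Λ), (∀ i ∈ U, q i ∈ I) → ∀ n,
      (U.filter fun i => h (q i) = n).card =
        ∑ l ∈ I with h l = n, (U.filter fun i => q i = l).card := by
    intro U q hq n
    rw [Finset.card_eq_sum_card_fiberwise (f := q) (t := I.filter fun l => h l = n)]
    · refine Finset.sum_congr rfl fun l hl => ?_
      rw [Finset.filter_filter]
      congr 1
      ext i
      simp only [Finset.mem_filter] at hl ⊢
      constructor
      · rintro ⟨h1, -, h2⟩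
        exact ⟨h1, h2⟩
      · rintro ⟨h1, h2⟩
        exact ⟨h1, by rw [h2]; exact hl.2, h2⟩
    · intro i hi
      have hi := Finset.mem_filter.1 (Finset.mem_coe.1 hi)
      exact Finset.mem_coe.2 (Finset.mem_filter.2 ⟨hq i hi.1, hi.2⟩)
  refine ⟨h, fun n => ?_⟩
  rw [hfib S f hSI n, hfib O g hOI n]
  constructor
  · have h1 := (hh n).1
    rw [ha, Finset.sum_sub_distrib, sub_eq_zero] at h1
    exact_mod_cast h1
  · calc _ ≤ ∑ l ∈ I with h l = n, M := Finset.sum_le_sum fun l _ => hg l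
      _ = (I.filter fun l => h l = n).card * M := by simp
      _ ≤ _ := Nat.mul_le_mul_right _ (hh n).2

/-- Bernoulli's inequality gives `2 ≤ (1 + e) ^ e⁻¹`. Hence `⌈d * e⁻¹⌉₊` shells suffice in region
growing. -/
theorem two_rpow_le_one_add_pow {e d : ℝ} (he : 0 < e) (he1 : e ≤ 1) (hd : 0 ≤ d) :
    (2 : ℝ) ^ d ≤ (1 + e) ^ ⌈d * e⁻¹⌉₊ := by
  have h1 : (2 : ℝ) ≤ (1 + e) ^ e⁻¹ := by
    have := one_add_mul_self_le_rpow_one_add (s := e) (p := e⁻¹) (by linarith)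
      ((one_le_inv₀ he).2 he1)
    rw [inv_mul_cancel₀ he.ne'] at this
    linarith
  calc (2 : ℝ) ^ d ≤ ((1 + e) ^ e⁻¹) ^ d := Real.rpow_le_rpow (by norm_num) h1 hd
    _ = (1 + e) ^ (d * e⁻¹) := by rw [← Real.rpow_mul (by linarith), mul_comm]
    _ ≤ (1 + e) ^ (⌈d * e⁻¹⌉₊ : ℝ) :=
      Real.rpow_le_rpow_of_exponent_le (by linarith) (Nat.le_ceil _)
    _ = _ := Real.rpow_natCast _ _

/-- The ratio that enters the packing bound for one cluster: its radius plus the distance of a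
centre from its representative, over the separation of net points in a band starting at `a`. -/
theorem packing_ratio_le {e d a : ℝ} (he : 0 < e) (he1 : e ≤ 1 / 1000) (hd : 1 ≤ d) (ha : 0 < a) :
    4 * (4 * (e⁻¹ ^ (⌈e⁻¹⌉₊ + 2) * a) * ⌈d * e⁻¹⌉₊ + e⁻¹ * (a * e⁻¹ ^ ⌈e⁻¹⌉₊)) / (e * a) ≤
      d * e⁻¹ ^ (2 * e⁻¹) := by
  set B : ℝ := e⁻¹ with hB
  have hB1 : 1000 ≤ B := by
    rw [hB, le_inv_comm₀ (by norm_num) he]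
    linarith
  set L := ⌈B⌉₊ with hL
  have hLB : (L : ℝ) < B + 1 := Nat.ceil_lt_add_one (by linarith)
  have hK : (⌈d * B⌉₊ : ℝ) ≤ 2 * (d * B) := by
    have h1 := Nat.ceil_lt_add_one (a := d * B) (by positivity)
    have h2 : 1 ≤ d * B := by nlinarith
    linarith
  have heB : e = B⁻¹ := by rw [hB, inv_inv]
  have hBL : 0 < B ^ L := by positivity
  have h1 : 4 * (4 * (B ^ (L + 2) * a) * ⌈d * B⌉₊ + B * (a * B ^ L)) / (e * a) =
      16 * B ^ (L + 3) * ⌈d * B⌉₊ + 4 * B ^ (L + 2) := by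
    rw [heB]
    field_simp
    ring
  rw [h1]
  have h2 : 4 * B ^ (L + 2) ≤ 4 * B ^ (L + 4) * d := by
    have : B ^ (L + 2) ≤ B ^ (L + 4) := pow_le_pow_right₀ (by linarith) (by omega)
    have h3 : 0 < B ^ (L + 4) := by positivity
    nlinarith
  have h3 : 16 * B ^ (L + 3) * ⌈d * B⌉₊ ≤ 32 * B ^ (L + 4) * d := by
    calc 16 * B ^ (L + 3) * ⌈d * B⌉₊ ≤ 16 * B ^ (L + 3) * (2 * (d * B)) := by gcongr
      _ = _ := by ring
  have h4 : 36 * B ^ (L + 4) * d ≤ B ^ (L + 5) * d := by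
    have : 36 * B ^ (L + 4) ≤ B * B ^ (L + 4) := by gcongr; linarith
    have h5 : B ^ (L + 5) = B * B ^ (L + 4) := by ring
    rw [h5]
    gcongr
  have h5 : B ^ (L + 5) ≤ B ^ (2 * B) := by
    rw [← Real.rpow_natCast]
    refine Real.rpow_le_rpow_of_exponent_le (by linarith) ?_
    push_cast
    linarith
  have h6 : B ^ (L + 5) * d ≤ B ^ (2 * B) * d := by gcongr
  linarith

/-- The square of the packing bound has exponents `2 * d` and `4 * d / e`, which leaves ample room
in `swapSize`. -/
theorem class_size_le_swapSize {e d : ℝ} (he : 0 < e) (he1 : e ≤ 1 / 1000) (hd : 1 ≤ d) :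
    (((2 * ⌊2 * (d * e⁻¹ ^ (2 * e⁻¹)) ^ d⌋₊ + 1) * ⌊2 * (d * e⁻¹ ^ (2 * e⁻¹)) ^ d⌋₊ : ℕ) : ℝ) ≤
      swapSize e d := by
  set B : ℝ := e⁻¹ with hB
  have hB1 : 1 ≤ B := by
    rw [hB, le_inv_comm₀ (by norm_num) he]
    linarith
  have hBB : 1 ≤ B ^ (2 * B) := Real.one_le_rpow hB1 (by linarith)
  set Z : ℝ := (d * B ^ (2 * B)) ^ d with hZ
  have hZ1 : 1 ≤ Z := Real.one_le_rpow (by nlinarith) (by linarith)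
  have hM : (⌊2 * Z⌋₊ : ℝ) ≤ 2 * Z := Nat.floor_le (by linarith)
  have hM0 : (0 : ℝ) ≤ ⌊2 * Z⌋₊ := Nat.cast_nonneg _
  push_cast
  have h1 : (2 * (⌊2 * Z⌋₊ : ℝ) + 1) * ⌊2 * Z⌋₊ ≤ 10 * Z ^ 2 := by nlinarith
  have h2 : Z ^ 2 = d ^ (2 * d) * B ^ (4 * B * d) := by
    rw [hZ, ← Real.rpow_natCast, ← Real.rpow_mul (by positivity),
      Real.mul_rpow (by positivity) (by positivity), ← Real.rpow_mul (by positivity)]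
    congr 2 <;> push_cast <;> ring
  have h3 : e ^ (-(256 * d / e)) = B ^ (256 * B * d) := by
    rw [hB, Real.inv_rpow he.le, ← Real.rpow_neg he.le]
    congr 1
    field_simp
  have h4 : d ^ (2 * d) ≤ d ^ (16 * d) := Real.rpow_le_rpow_of_exponent_le hd (by linarith)
  have h5 : B ^ (4 * B * d) ≤ B ^ (256 * B * d) :=
    Real.rpow_le_rpow_of_exponent_le hB1 (by gcongr; norm_num)
  have h6 : Z ^ 2 ≤ d ^ (16 * d) * B ^ (256 * B * d) := by
    rw [h2]; gcongr
  have h7 : 0 ≤ d ^ (16 * d) * B ^ (256 * B * d) := by positivity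
  unfold swapSize
  rw [h3]
  nlinarith

/-! ### The labelling of the centres. -/

namespace Pairing

variable {V : Type u} [MetricSpace V] {m : ℕ} {y : Fin m → V} {S O : Finset (Fin m)}
  (A : Pairing y S O)

/-- The vertex that stands for `v` in `O`: paired centres are represented by their partner. -/
noncomputable def rep (e : ℝ) (v : Fin m) : Fin m ⊕ Fin m :=
  open Classical in if A.Paired e v then Sum.inl (A.toS v) else Sum.inr v

theorem rep_injOn {e : ℝ} {v w : Fin m} (h : A.rep e v = A.rep e w) : v = w := by
  unfold rep at h
  split_ifs at h with h1 h2 h2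
  · exact h1.eq h2 (Sum.inl_injective h)
  · exact Sum.inr_injective h

noncomputable def scale : Fin m ⊕ Fin m → ℝ := Sum.elim A.distO A.distS

theorem scale_rep_le {e : ℝ} {v : Fin m} (hv : v ∈ O) : A.scale (A.rep e v) ≤ A.distS v := by
  unfold rep
  split_ifs with h
  · exact A.distO_toS_le hv
  · exact le_refl _

theorem le_scale_rep {e : ℝ} (he1 : e ≤ 1) (v : Fin m) :
    e * A.distS v ≤ A.scale (A.rep e v) := by
  unfold rep
  split_ifs with h
  · exact h.2.2
  · exact mul_le_of_le_one_left dist_nonneg he1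

theorem dist_rep_le (e : ℝ) (v : Fin m) :
    dist (y v) (Sum.elim y y (A.rep e v)) ≤ A.distS v := by
  unfold rep
  split_ifs with h
  · exact le_refl _
  · simp [distS]

/-- There is a labelling of the centres with small balanced classes that keeps pairs together and
puts most of the given pairs of net points of comparable scales together. -/
theorem exists_labelling {d : ℝ} (hV : DoublingDimLE V d) (hd : 1 ≤ d) {e : ℝ} (he : 0 < e)
    (he1 : e ≤ 1 / 1000) (hcard : S.card = O.card) {N N' : Finset (Fin m)}
    (hN' : N' ⊆ O)
    (hsep : ∀ a ∈ N, ∀ b ∈ N, a ≠ b → e * min (A.distO a) (A.distO b) < dist (y a) (y b))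
    (hsep' : ∀ a ∈ N', ∀ b ∈ N', a ≠ b → e * min (A.distS a) (A.distS b) < dist (y a) (y b))
    {ι : Type*} (J : Finset ι) (W : ι → ℝ) (hW : ∀ j, 0 ≤ W j) (i v : ι → Fin m) (R : ι → ℝ)
    (hiN : ∀ j ∈ J, i j ∈ N) (hvN : ∀ j ∈ J, v j ∈ N') (hR : ∀ j ∈ J, 0 < R j)
    (hi1 : ∀ j ∈ J, (1 - e) * (e * R j) ≤ A.distO (i j))
    (hi2 : ∀ j ∈ J, A.distO (i j) ≤ (1 + e) * R j)
    (hv1 : ∀ j ∈ J, (1 - e) * (e * R j) ≤ A.distS (v j))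
    (hv2 : ∀ j ∈ J, A.distS (v j) ≤ (1 + e) * R j)
    (hiv : ∀ j ∈ J, dist (y (i j)) (y (v j)) ≤ (1 + 2 * e) * R j) :
    ∃ f g : Fin m → ℕ, (∀ v, A.Paired e v → g v = f (A.toS v)) ∧
      (∀ l, (S.filter fun i => f i = l).card = (O.filter fun v => g v = l).card ∧
        ((O.filter fun v => g v = l).card : ℝ) ≤ swapSize e d) ∧
      ∑ j ∈ J with f (i j) ≠ g (v j), W j ≤ 4 * e * ∑ j ∈ J, W j := by
  classical
  have hB : 0 < e⁻¹ := inv_pos.2 he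
  have hs1 : ∀ j ∈ J, e * ((1 - e) * (e * R j)) ≤ A.scale (A.rep e (v j)) := fun j hj =>
    (mul_le_mul_of_nonneg_left (hv1 j hj) he.le).trans (A.le_scale_rep (by linarith) _)
  have hs2 : ∀ j ∈ J, A.scale (A.rep e (v j)) ≤ (1 + e) * R j := fun j hj =>
    (A.scale_rep_le (hN' (hvN j hj))).trans (hv2 j hj)
  have hK0 : 0 < ⌈d * e⁻¹⌉₊ := Nat.ceil_pos.2 (by positivity)
  obtain ⟨band, lo, s, hlo, hband, hball, hcut⟩ := hV.exists_scaled_clustering (Sum.elim y y)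
    A.scale W hW (fun j => Sum.inl (i j)) (fun j => A.rep e (v j)) J he (by linarith)
    (L := ⌈e⁻¹⌉₊) hK0 (two_rpow_le_one_add_pow he (by linarith) (by linarith))
    (Nat.le_ceil _)
    (fun j hj => lt_of_lt_of_le (by
      have := hR j hj
      have : 0 < 1 - e := by linarith
      positivity) (hi1 j hj))
    (fun j hj => lt_of_lt_of_le (by
      have := hR j hj
      have : 0 < 1 - e := by linarith
      positivity) (hs1 j hj))
    (fun j hj => by
      have h0 := hR j hj
      have h1 : A.scale (Sum.inl (i j)) ≤ (1 + e) * R j := hi2 j hj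
      rw [inv_pow, le_inv_mul_iff₀ (by positivity)]
      refine le_trans ?_ (hs1 j hj)
      calc e ^ 3 * A.scale (Sum.inl (i j)) ≤ e ^ 3 * ((1 + e) * R j) := by gcongr
        _ = e * ((e * (1 + e)) * (e * R j)) := by ring
        _ ≤ _ := by gcongr; nlinarith)
    (fun j hj => by
      have h0 := hR j hj
      rw [inv_pow, le_inv_mul_iff₀ (by positivity)]
      refine le_trans ?_ (hi1 j hj)
      calc e ^ 3 * A.scale (A.rep e (v j)) ≤ e ^ 3 * ((1 + e) * R j) := by
            gcongr; exact hs2 j hj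
        _ = (e * e * (1 + e)) * (e * R j) := by ring
        _ ≤ _ := by gcongr; nlinarith)
    (fun j hj => by
      have h0 := hR j hj
      rw [inv_pow, le_inv_mul_iff₀ (by positivity)]
      refine le_trans ?_ (hi1 j hj)
      have h1 := dist_triangle (y (i j)) (y (v j)) (Sum.elim y y (A.rep e (v j)))
      have h2 := A.dist_rep_le e (v j)
      have h3 := hiv j hj
      have h4 := hv2 j hj
      have h5 : dist (y (i j)) (Sum.elim y y (A.rep e (v j))) ≤ 3 * R j := by nlinarith
      calc e ^ 2 * dist (y (i j)) (Sum.elim y y (A.rep e (v j))) ≤ e ^ 2 * (3 * R j) := by gcongr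
        _ = (e * 3) * (e * R j) := by ring
        _ ≤ _ := by gcongr; nlinarith)
  -- Only net points, or the partners that represent them, are clustered. A cluster may contain
  -- arbitrarily many other centres; these get singleton labels, as do vertices of scale zero.
  set rel : Finset (Fin m ⊕ Fin m) := N.image Sum.inl ∪ N'.image (A.rep e) with hrel
  let lab : Fin m ⊕ Fin m → (Fin m ⊕ Fin m) ⊕ (Σ b : ℤ, Quotient (s b)) := fun z =>
    if z ∈ rel ∧ 0 < A.scale z then Sum.inr ⟨band z, Quotient.mk (s (band z)) (Sum.elim y y z)⟩
    else Sum.inl z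
  set Z : ℝ := (d * e⁻¹ ^ (2 * e⁻¹)) ^ d with hZ
  have hB1 : 1 ≤ e⁻¹ := (one_le_inv₀ he).2 (by linarith)
  have hZ1 : 1 ≤ Z := by
    have : 1 ≤ e⁻¹ ^ (2 * e⁻¹) := Real.one_le_rpow hB1 (by linarith)
    exact Real.one_le_rpow (by nlinarith) (by linarith)
  have hpack : ∀ (U : Finset (Fin m)) (r : Fin m → ℝ) (b : ℤ) (p : V),
      (∀ a ∈ U, ∀ b ∈ U, a ≠ b → e * min (r a) (r b) < dist (y a) (y b)) →
      (∀ a ∈ U, lo b ≤ r a) →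
      (∀ a ∈ U, dist (y a) p ≤ 4 * (e⁻¹ ^ (⌈e⁻¹⌉₊ + 2) * lo b) * ⌈d * e⁻¹⌉₊ +
        e⁻¹ * (lo b * e⁻¹ ^ ⌈e⁻¹⌉₊)) → (U.card : ℝ) ≤ Z := by
    intro U r b p h1 h2 h3
    have hlob := hlo b
    refine (hV.card_le_of_separated (by linarith) U y p (r := e * lo b) (by positivity) ?_ h3
      fun a ha c hc hac => ?_).trans ?_
    · have h4 : 1 ≤ e⁻¹ ^ ⌈e⁻¹⌉₊ := one_le_pow₀ hB1
      have h5 : lo b ≤ lo b * e⁻¹ ^ ⌈e⁻¹⌉₊ := le_mul_of_one_le_right hlob.le h4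
      have h6 : lo b * e⁻¹ ^ ⌈e⁻¹⌉₊ ≤ e⁻¹ * (lo b * e⁻¹ ^ ⌈e⁻¹⌉₊) :=
        le_mul_of_one_le_left (by positivity) hB1
      have h7 : e * lo b ≤ lo b := mul_le_of_le_one_left hlob.le (by linarith)
      have h8 : 0 ≤ 4 * (e⁻¹ ^ (⌈e⁻¹⌉₊ + 2) * lo b) * ⌈d * e⁻¹⌉₊ := by positivity
      linarith
    · refine lt_of_le_of_lt ?_ (h1 a ha c hc hac)
      gcongr
      exact le_min (h2 a ha) (h2 c hc)
    · exact Real.rpow_le_rpow (by positivity) (packing_ratio_le he he1 hd hlob) (by linarith)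
  have hclass : ∀ (Y : Finset (Fin m ⊕ Fin m)) l, (Y.filter fun z => lab z = l).card ≤ ⌊2 * Z⌋₊ := by
    intro Y l
    rcases l with z₀ | ⟨b, q⟩
    · have h1 : (Y.filter fun z => lab z = Sum.inl z₀) ⊆ {z₀} := by
        intro z hz
        have hz := (Finset.mem_filter.1 hz).2
        rw [Finset.mem_singleton]
        dsimp only [lab] at hz
        split_ifs at hz with h
        exact Sum.inl_injective hz
      refine (Finset.card_le_card h1).trans ?_
      rw [Finset.card_singleton]
      exact Nat.le_floor (by push_cast; linarith)
    · obtain ⟨p, rfl⟩ := Quotient.exists_rep q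
      obtain ⟨c, hc⟩ := hball b p
      have hlab : ∀ z, lab z = Sum.inr ⟨b, Quotient.mk (s b) p⟩ →
          z ∈ rel ∧ 0 < A.scale z ∧ band z = b ∧ s b p (Sum.elim y y z) := by
        intro z hz
        dsimp only [lab] at hz
        split_ifs at hz with h
        have hz := Sum.inr_injective hz
        obtain ⟨hb, hq⟩ := Sigma.mk.inj_iff.1 hz
        subst hb
        exact ⟨h.1, h.2, rfl, (s _).symm (Quotient.exact (eq_of_heq hq))⟩
      let U := N.filter fun a => 0 < A.scale (Sum.inl a) ∧ band (Sum.inl a) = b ∧ s b p (y a)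
      let U' := N'.filter fun a => 0 < A.scale (A.rep e a) ∧ band (A.rep e a) = b ∧
        s b p (Sum.elim y y (A.rep e a))
      have hU : (U.card : ℝ) ≤ Z := by
        refine hpack U A.distO b c (fun a ha a' ha' => hsep a (Finset.mem_filter.1 ha).1 a'
          (Finset.mem_filter.1 ha').1) (fun a ha => ?_) fun a ha => ?_
        · obtain ⟨-, h1, h2, -⟩ := Finset.mem_filter.1 ha
          rw [← h2]
          exact (hband _ h1).1
        · obtain ⟨-, -, -, h3⟩ := Finset.mem_filter.1 ha
          refine (hc _ h3).trans (le_add_of_nonneg_right ?_)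
          have := hlo b
          positivity
      -- Separation is known for the centres of `N'`, not for their representatives, so packing is
      -- done at the original positions. This enlarges the radius by `distS a`, which is at most
      -- `e⁻¹` times the scale of the representative.
      have hU' : (U'.card : ℝ) ≤ Z := by
        refine hpack U' A.distS b c (fun a ha a' ha' => hsep' a (Finset.mem_filter.1 ha).1 a'
          (Finset.mem_filter.1 ha').1) (fun a ha => ?_) fun a ha => ?_
        · obtain ⟨h0, h1, h2, -⟩ := Finset.mem_filter.1 ha
          rw [← h2]
          exact (hband _ h1).1.trans (A.scale_rep_le (hN' h0))
        · obtain ⟨-, h1, h2, h3⟩ := Finset.mem_filter.1 ha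
          have h4 := dist_triangle (y a) (Sum.elim y y (A.rep e a)) c
          have h5 := A.dist_rep_le e a
          have h6 := hc _ h3
          have h7 : A.distS a ≤ e⁻¹ * A.scale (A.rep e a) := by
            rw [le_inv_mul_iff₀ he]
            exact A.le_scale_rep (by linarith) a
          have h8 := (hband _ h1).2
          rw [h2] at h8
          have h9 : e⁻¹ * A.scale (A.rep e a) ≤ e⁻¹ * (lo b * e⁻¹ ^ ⌈e⁻¹⌉₊) := by gcongr
          linarith
      have hsub : (Y.filter fun z => lab z = Sum.inr ⟨b, Quotient.mk (s b) p⟩) ⊆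
          U.image Sum.inl ∪ U'.image (A.rep e) := by
        intro z hz
        obtain ⟨h1, h2, h3, h4⟩ := hlab z (Finset.mem_filter.1 hz).2
        rw [hrel, Finset.mem_union, Finset.mem_image, Finset.mem_image] at h1
        rw [Finset.mem_union, Finset.mem_image, Finset.mem_image]
        rcases h1 with ⟨a, ha, rfl⟩ | ⟨a, ha, rfl⟩
        · exact Or.inl ⟨a, Finset.mem_filter.2 ⟨ha, h2, h3, h4⟩, rfl⟩
        · exact Or.inr ⟨a, Finset.mem_filter.2 ⟨ha, h2, h3, h4⟩, rfl⟩
      have hle : (Y.filter fun z => lab z = Sum.inr ⟨b, Quotient.mk (s b) p⟩).card ≤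
          U.card + U'.card :=
        (Finset.card_le_card hsub).trans ((Finset.card_union_le _ _).trans
          (add_le_add Finset.card_image_le Finset.card_image_le))
      refine hle.trans (Nat.le_floor ?_)
      push_cast
      linarith
  have hinj : ∀ (U : Finset (Fin m)) (q : Fin m → Fin m ⊕ Fin m), Function.Injective q →
      ∀ l, (U.filter fun a => lab (q a) = l).card ≤ ⌊2 * Z⌋₊ := by
    intro U q hq l
    refine le_trans ?_ (hclass (U.image q) l)
    rw [← Finset.card_image_of_injective _ hq]
    refine Finset.card_le_card fun z hz => ?_
    obtain ⟨a, ha, rfl⟩ := Finset.mem_image.1 hz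
    obtain ⟨h1, h2⟩ := Finset.mem_filter.1 ha
    exact Finset.mem_filter.2 ⟨Finset.mem_image_of_mem _ h1, h2⟩
  obtain ⟨h, hh⟩ := exists_balanced_merging S O (fun a => lab (Sum.inl a))
    (fun a => lab (A.rep e a)) ⌊2 * Z⌋₊ hcard (hinj S _ Sum.inl_injective)
    (hinj O _ fun _ _ h => A.rep_injOn h)
  -- A centre of `O` takes the label of its representative, so pairs stay together by construction.
  refine ⟨fun a => h (lab (Sum.inl a)), fun a => h (lab (A.rep e a)), ?_, ?_, ?_⟩
  · intro a ha
    have : A.rep e a = Sum.inl (A.toS a) := if_pos ha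
    dsimp only
    rw [this]
  · intro l
    refine ⟨(hh l).1, le_trans ?_ (class_size_le_swapSize he he1 hd)⟩
    exact_mod_cast (hh l).2
  · refine le_trans (Finset.sum_le_sum_of_subset_of_nonneg (fun j hj => ?_)
      fun j _ _ => hW j) hcut
    obtain ⟨hj, hne⟩ := Finset.mem_filter.1 hj
    refine Finset.mem_filter.2 ⟨hj, fun hcon => hne ?_⟩
    have hrel1 : Sum.inl (i j) ∈ rel ∧ 0 < A.scale (Sum.inl (i j)) :=
      ⟨Finset.mem_union_left _ (Finset.mem_image_of_mem _ (hiN j hj)), lt_of_lt_of_le (by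
        have := hR j hj
        have : 0 < 1 - e := by linarith
        positivity) (hi1 j hj)⟩
    have hrel2 : A.rep e (v j) ∈ rel ∧ 0 < A.scale (A.rep e (v j)) :=
      ⟨Finset.mem_union_right _ (Finset.mem_image_of_mem _ (hvN j hj)), lt_of_lt_of_le (by
        have := hR j hj
        have : 0 < 1 - e := by linarith
        positivity) (hs1 j hj)⟩
    have hlab : lab (Sum.inl (i j)) = lab (A.rep e (v j)) := by
      dsimp only [lab]
      rw [if_pos hrel1, if_pos hrel2]
      obtain ⟨h1, h2⟩ := hcon
      have h3 : (⟨band (Sum.inl (i j)), Quotient.mk (s (band (Sum.inl (i j))))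
          (Sum.elim y y (Sum.inl (i j)))⟩ : Σ b : ℤ, Quotient (s b)) =
          ⟨band (Sum.inl (i j)), Quotient.mk (s (band (Sum.inl (i j))))
            (Sum.elim y y (A.rep e (v j)))⟩ := by
        congr 1
        exact Quotient.sound h2
      rw [h3, h1]
    dsimp only
    rw [hlab]

end Pairing

/-! ### The approximation guarantee of local optima. -/

theorem exists_net_map {α : Type*} [DecidableEq α] {V : Type u} [MetricSpace V]
    (y : α → V) (r : α → ℝ) (hr : ∀ a, 0 ≤ r a) {e : ℝ} (he : 0 ≤ e) (S : Finset α) :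
    ∃ N ⊆ S, (∀ a ∈ N, ∀ b ∈ N, a ≠ b → e * min (r a) (r b) < dist (y a) (y b)) ∧
      ∀ a ∈ S, ∃ b ∈ N, dist (y a) (y b) ≤ e * r a := by
  obtain ⟨N, hN, h1, h2⟩ := exists_net S
    (fun a b => e * min (r a) (r b) < dist (y a) (y b))
    (fun a b h => by rwa [min_comm, dist_comm])
  refine ⟨N, hN, h1, fun a ha => ?_⟩
  obtain ⟨b, hb, rfl | h⟩ := h2 a ha
  · exact ⟨b, hb, by rw [dist_self]; exact mul_nonneg he (hr b)⟩
  · refine ⟨b, hb, (not_lt.1 h).trans ?_⟩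
    gcongr
    exact min_le_left _ _

/-- Local optima are nearly optimal. -/
theorem cost_le_of_isLocalOpt {V : Type u} [MetricSpace V] {d : ℝ} (hV : DoublingDimLE V d)
    (hd : 1 ≤ d) {n m k : ℕ} {x : Fin n → V} {y : Fin m → V} (hk : 1 ≤ k) {e θ : ℝ} (he : 0 < e)
    (he1 : e ≤ 1 / 1000) (hθ0 : 0 ≤ θ) (hθ : θ * k ≤ e) {S O : Finset (Fin m)}
    (hS : S.card = k) (hO : O.card = k) (hloc : IsLocalOpt x y θ (swapSize e d) S) :
    cost x y S ≤ (1 + 1000 * e) * cost x y O := by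
  classical
  have hSne : S.Nonempty := Finset.card_pos.1 (by omega)
  have hOne : O.Nonempty := Finset.card_pos.1 (by omega)
  obtain ⟨A⟩ := exists_pairing y hSne hOne
  choose σ hσS hσ hσmin using fun j => exists_nearest (y := y) hSne (x j)
  choose τ hτO hτ hτmin using fun j => exists_nearest (y := y) hOne (x j)
  obtain ⟨N, hNS, hNsep, hN⟩ := exists_net_map y A.distO (fun _ => dist_nonneg) he.le S
  obtain ⟨N', hNO, hNsep', hN'⟩ := exists_net_map y A.distS (fun _ => dist_nonneg) he.le O
  choose! ν hνN hν using hN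
  choose! μ hμN hμ using hN'
  set W : Fin n → ℝ := fun j => dist (x j) (y (σ j)) ^ 2 + dist (x j) (y (τ j)) ^ 2 with hW
  have hW0 : ∀ j, 0 ≤ W j := fun j => by positivity
  set R : Fin n → ℝ := fun j => dist (x j) (y (σ j)) + dist (x j) (y (τ j)) with hR
  -- The clients without a cheap fallback. For them `distO (σ j)` and `distS (τ j)` both lie between
  -- `e * R j` and `R j`, so the edge joins comparable scales.
  set J : Finset (Fin n) := Finset.univ.filter fun j =>
    e * R j < A.distO (σ j) ∧ e * R j < A.distS (τ j) with hJ
  have hcS : cost x y S = ∑ j, dist (x j) (y (σ j)) ^ 2 :=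
    Finset.sum_congr rfl fun j _ => by rw [hσ]
  have hcO : cost x y O = ∑ j, dist (x j) (y (τ j)) ^ 2 :=
    Finset.sum_congr rfl fun j _ => by rw [hτ]
  have hstR : ∀ j, dist (y (σ j)) (y (τ j)) ≤ R j := fun j => dist_triangle_left _ _ _
  have hDR : ∀ j, A.distO (σ j) ≤ R j := fun j => (A.toO_le _ _ (hτO j)).trans (hstR j)
  have hER : ∀ j, A.distS (τ j) ≤ R j := fun j =>
    (A.toS_le _ _ (hσS j)).trans (by rw [dist_comm]; exact hstR j)
  have hR0 : ∀ j, 0 ≤ R j := fun j => add_nonneg dist_nonneg dist_nonneg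
  have hνσ := fun j => hν _ (hσS j)
  have hμτ := fun j => hμ _ (hτO j)
  have heD : ∀ j, e * A.distO (σ j) ≤ e * R j := fun j => by gcongr; exact hDR j
  have heE : ∀ j, e * A.distS (τ j) ≤ e * R j := fun j => by gcongr; exact hER j
  obtain ⟨f, g, hfg, hbal, hcut⟩ := A.exists_labelling hV hd he he1 (hS.trans hO.symm) hNO
    hNsep hNsep' J W hW0 (fun j => ν (σ j)) (fun j => μ (τ j)) R
    (fun j _ => hνN _ (hσS j)) (fun j _ => hμN _ (hτO j))
    (fun j hj => by
      have h1 := (Finset.mem_filter.1 hj).2.1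
      rcases (hR0 j).lt_or_eq with h | h
      · exact h
      · have := hDR j
        rw [← h] at h1 this
        linarith)
    (fun j hj => by
      have h1 := (Finset.mem_filter.1 hj).2.1
      have h2 := A.distO_le_add (σ j) (ν (σ j))
      have h3 := hνσ j
      have h4 : (1 - e) * (e * R j) ≤ (1 - e) * A.distO (σ j) :=
        mul_le_mul_of_nonneg_left h1.le (by linarith)
      linarith)
    (fun j hj => by
      have h2 := A.distO_le_add (ν (σ j)) (σ j)
      rw [dist_comm] at h2
      linarith [hνσ j, hDR j, heD j])
    (fun j hj => by
      have h1 := (Finset.mem_filter.1 hj).2.2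
      have h2 := A.distS_le_add (τ j) (μ (τ j))
      have h3 := hμτ j
      have h4 : (1 - e) * (e * R j) ≤ (1 - e) * A.distS (τ j) :=
        mul_le_mul_of_nonneg_left h1.le (by linarith)
      linarith)
    (fun j hj => by
      have h2 := A.distS_le_add (μ (τ j)) (τ j)
      rw [dist_comm] at h2
      linarith [hμτ j, hER j, heE j])
    (fun j hj => by
      have h1 := dist_triangle4 (y (ν (σ j))) (y (σ j)) (y (τ j)) (y (μ (τ j)))
      rw [dist_comm (y (ν (σ j))) (y (σ j))] at h1
      linarith [hνσ j, hμτ j, hstR j, heD j, heE j])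
  -- The labels in use. There are at most `k` of them, so the tolerances add up to at most `e * cost
  -- x y S`.
  set I : Finset ℕ := S.image f with hI
  have hgI : ∀ v ∈ O, g v ∈ I := by
    intro v hv
    have h1 : 0 < (O.filter fun w => g w = g v).card :=
      Finset.card_pos.2 ⟨v, Finset.mem_filter.2 ⟨hv, rfl⟩⟩
    rw [← (hbal (g v)).1] at h1
    obtain ⟨i, hi⟩ := Finset.card_pos.1 h1
    rw [Finset.mem_filter] at hi
    exact Finset.mem_image.2 ⟨i, hi.1, hi.2⟩
  have hIk : (I.card : ℝ) ≤ k := by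
    rw [← hS]
    exact_mod_cast Finset.card_image_le
  set b : Fin n → ℝ := fun j => if j ∈ J ∧ f (ν (σ j)) ≠ g (μ (τ j)) then W j else 0 with hb
  have hb0 : ∀ j, 0 ≤ b j := fun j => by
    dsimp only [b]
    split_ifs
    · exact hW0 j
    · exact le_refl _
  have hbsum : ∑ j, b j ≤ 4 * e * ∑ j, W j := by
    have h1 : ∑ j, b j = ∑ j ∈ J with f (ν (σ j)) ≠ g (μ (τ j)), W j := by
      rw [hb, ← Finset.sum_filter]
      congr 1
      ext j
      simp
    rw [h1]
    refine hcut.trans ?_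
    gcongr
    exact Finset.subset_univ J
  have hassign := fun j => A.exists_assignment he (by linarith) hfg I (x j) (hσS j) (hτO j)
    (Finset.mem_image_of_mem f (hσS j)) (hgI _ (hτO j)) (hNS (hνN _ (hσS j))) (hνσ j)
    (hNO (hμN _ (hτO j))) (hμτ j) (hb0 j) (fun h1 h2 h3 => by
      have : j ∈ J ∧ f (ν (σ j)) ≠ g (μ (τ j)) :=
        ⟨Finset.mem_filter.2 ⟨Finset.mem_univ _, h1, h2⟩, h3⟩
      dsimp only [b]
      rw [if_pos this])
  choose c hc hcsum using hassign
  have htest : ∀ l, (1 - θ) * cost x y S ≤ ∑ j, dist (x j) (y (c j l)) ^ 2 := by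
    intro l
    refine hloc.le_of_assignment (P := O.filter fun v => g v = l)
      (Q := S.filter fun i => f i = l) (Finset.filter_subset _ _) (hbal l).1.ge (hbal l).2
      (fun j => c j l) fun j => ?_
    rw [Finset.mem_union, Finset.mem_sdiff, Finset.mem_filter, Finset.mem_filter]
    rcases hc j l with ⟨h1, h2⟩ | h
    · exact Or.inl ⟨h1, fun h => h2 h.2⟩
    · exact Or.inr h
  have hcS0 : 0 ≤ cost x y S := cost_nonneg S
  have hcO0 : 0 ≤ cost x y O := cost_nonneg O
  have hlow : -(e * cost x y S) ≤
      ∑ j, ∑ l ∈ I, (dist (x j) (y (c j l)) ^ 2 - dist (x j) (y (σ j)) ^ 2) := by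
    rw [Finset.sum_comm]
    have h1 : ∑ l ∈ I, -(θ * cost x y S) ≤
        ∑ l ∈ I, ∑ j, (dist (x j) (y (c j l)) ^ 2 - dist (x j) (y (σ j)) ^ 2) := by
      refine Finset.sum_le_sum fun l _ => ?_
      rw [Finset.sum_sub_distrib, ← hcS]
      linarith [htest l]
    refine le_trans ?_ h1
    rw [Finset.sum_const, nsmul_eq_mul]
    have h2 : I.card * (θ * cost x y S) ≤ k * (θ * cost x y S) := by gcongr
    have h3 : θ * k * cost x y S ≤ e * cost x y S := by gcongr
    linarith
  have hup : ∑ j, ∑ l ∈ I, (dist (x j) (y (c j l)) ^ 2 - dist (x j) (y (σ j)) ^ 2) ≤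
      cost x y O - cost x y S + 48 * e * (cost x y S + cost x y O) + 32 * ∑ j, b j := by
    refine (Finset.sum_le_sum fun j _ => hcsum j).trans (le_of_eq ?_)
    rw [Finset.sum_add_distrib, Finset.sum_add_distrib, Finset.sum_sub_distrib, ← hcS, ← hcO,
      ← Finset.mul_sum, ← Finset.mul_sum, Finset.sum_add_distrib, ← hcS, ← hcO]
  have hWsum : ∑ j, W j = cost x y S + cost x y O := by
    rw [hW, Finset.sum_add_distrib, ← hcS, ← hcO]
  rw [hWsum] at hbsum
  -- Here `176 = 48 + 32 * 4` combines reassignment errors and separated edges; the tolerance adds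
  -- one more `e` on the left.
  have hmain : cost x y S * (1 - 177 * e) ≤ cost x y O * (1 + 176 * e) := by nlinarith
  have h1 : 0 < 1 - 177 * e := by linarith
  have h2 : 1 + 176 * e ≤ (1 + 1000 * e) * (1 - 177 * e) := by nlinarith
  refine le_of_mul_le_mul_right (hmain.trans ?_) h1
  calc cost x y O * (1 + 176 * e) ≤ cost x y O * ((1 + 1000 * e) * (1 - 177 * e)) := by gcongr
    _ = _ := by ring

theorem cost_eq_zero_of_subsingleton {V : Type u} [MetricSpace V] [Subsingleton V] {n m : ℕ}
    {x : Fin n → V} {y : Fin m → V} {S : Finset (Fin m)} (hS : S.Nonempty) : cost x y S = 0 := by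
  refine Finset.sum_eq_zero fun j _ => ?_
  obtain ⟨i, -, h, -⟩ := exists_nearest (y := y) hS (x j)
  rw [h, Subsingleton.elim (x j) (y i), dist_self]
  norm_num

/-- Bound on the number of substantial improvements. -/
theorem improvement_count_le {V : Type u} [MetricSpace V] {n m k : ℕ} {x : Fin n → V}
    {y : Fin m → V} (hk : 1 ≤ k) {ε ρ : ℝ} (hε : 0 < ε) (hε1 : ε < 1) {O : Finset (Fin m)}
    (hO0 : 0 < cost x y O) (hO : ∀ T : Finset (Fin m), T.card = k → cost x y O ≤ cost x y T)
    (t : ℕ) (S : ℕ → Finset (Fin m)) (hS : (S 0).card = k)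
    (hstep : ∀ i < t, IsSwap ρ (S i) (S (i + 1)) ∧
      cost x y (S (i + 1)) < (1 - ε / k) * cost x y (S i)) :
    (t : ℝ) ≤ Real.log (cost x y (S 0) / cost x y O) / Real.log (1 / (1 - ε / k)) := by
  have hk' : (1 : ℝ) ≤ k := by exact_mod_cast hk
  have hq : ε / k < 1 := by rw [div_lt_one (by linarith)]; linarith
  have hq0 : 0 < ε / k := by positivity
  have hind : ∀ i ≤ t, (S i).card = k ∧ cost x y (S i) ≤ (1 - ε / k) ^ i * cost x y (S 0) := by
    intro i
    induction i with
    | zero => intro _; exact ⟨hS, by simp⟩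
    | succ i ih =>
      intro hi
      obtain ⟨h1, h2⟩ := ih (by omega)
      obtain ⟨⟨P, Q, hP, hQ, hcard, -, h⟩, h4⟩ := hstep i (by omega)
      constructor
      · rw [h, Finset.card_union_of_disjoint, Finset.card_sdiff_of_subset hQ, hcard]
        · have := Finset.card_le_card hQ
          omega
        · exact (Finset.disjoint_of_subset_right Finset.sdiff_subset hP).symm
      · calc cost x y (S (i + 1)) ≤ (1 - ε / k) * cost x y (S i) := h4.le
          _ ≤ (1 - ε / k) * ((1 - ε / k) ^ i * cost x y (S 0)) :=
            mul_le_mul_of_nonneg_left h2 (by linarith)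
          _ = _ := by ring
  obtain ⟨h1, h2⟩ := hind t le_rfl
  have h3 := (hO _ h1).trans h2
  have hq1 : 0 < 1 - ε / k := by linarith
  have hpow : 0 < (1 - ε / k) ^ t := by positivity
  have hlog : 0 < Real.log (1 / (1 - ε / k)) :=
    Real.log_pos (by rw [lt_div_iff₀ hq1]; linarith)
  rw [le_div_iff₀ hlog, ← Real.log_pow]
  refine Real.log_le_log (by positivity) ?_
  rw [le_div_iff₀ hO0, one_div, inv_pow, inv_mul_le_iff₀ hpow]
  exact h3

/-! ### Correctness and running time of the subroutines. -/

@[simp] theorem Timed.bind_val {α β : Type} (a : Timed α) (f : α → Timed β) :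
    (a >>= f).val = (f a.val).val := rfl

@[simp] theorem Timed.bind_time {α β : Type} (a : Timed α) (f : α → Timed β) :
    (a >>= f).time = a.time + (f a.val).time := rfl

@[simp] theorem Timed.pure_val {α : Type} (a : α) : (pure a : Timed α).val = a := rfl

@[simp] theorem Timed.pure_time {α : Type} (a : α) : (pure a : Timed α).time = 0 := rfl

@[simp] theorem tick_time (t : ℕ) : (tick t).time = t := rfl

theorem mem_chooseT {α : Type} (r : ℕ) (l s : List α) :
    s ∈ (chooseT r l).val ↔ s.Sublist l ∧ s.length = r := by
  induction l generalizing r s with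
  | nil =>
    cases r with
    | zero => simp +contextual [chooseT]
    | succ r =>
      simp only [chooseT, Timed.bind_val, Timed.pure_val, List.not_mem_nil, false_iff, not_and,
        List.sublist_nil]
      rintro rfl
      simp
  | cons a l ih =>
    cases r with
    | zero =>
      simp only [chooseT, Timed.bind_val, Timed.pure_val, List.mem_singleton,
        List.length_eq_zero_iff]
      constructor
      · rintro rfl
        exact ⟨List.nil_sublist _, rfl⟩
      · exact fun h => h.2
    | succ r =>
      simp only [chooseT, Timed.bind_val, Timed.pure_val, List.mem_append, List.mem_map, ih]
      constructor
      · rintro (⟨t, ⟨h1, h2⟩, rfl⟩ | ⟨h1, h2⟩)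
        · exact ⟨h1.cons_cons a, by simp [h2]⟩
        · exact ⟨h1.cons a, h2⟩
      · rintro ⟨h1, h2⟩
        cases h1 with
        | cons _ h => exact Or.inr ⟨h, h2⟩
        | cons_cons _ h => exact Or.inl ⟨_, ⟨h, by simpa using h2⟩, rfl⟩

theorem length_chooseT_le {α : Type} (r : ℕ) (l : List α) :
    (chooseT r l).val.length ≤ l.length ^ r := by
  induction l generalizing r with
  | nil => cases r <;> simp [chooseT]
  | cons a l ih =>
    cases r with
    | zero => simp [chooseT]
    | succ r =>
      simp only [chooseT, Timed.bind_val, Timed.pure_val, List.length_append, List.length_map,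
        List.length_cons]
      have h1 := ih r
      have h2 := ih (r + 1)
      have h3 : l.length ^ r ≤ (l.length + 1) ^ r := Nat.pow_le_pow_left (by omega) r
      calc _ ≤ l.length ^ r + l.length ^ (r + 1) := add_le_add h1 h2
        _ = (l.length + 1) * l.length ^ r := by ring
        _ ≤ (l.length + 1) * (l.length + 1) ^ r := Nat.mul_le_mul_left _ h3
        _ = _ := by ring

/-- The recursion closes because `(L + 1) ^ (r + 2) + 2 * (L + 1) ^ (r + 1) ≤ (L + 2) ^ (r + 2)`;
the second summand pays for the shorter sublists and the copying. -/
theorem chooseT_time_le {α : Type} (r : ℕ) (l : List α) :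
    (chooseT r l).time ≤ 2 * (r + 2) * (l.length + 1) ^ (r + 1) := by
  induction l generalizing r with
  | nil =>
    cases r with
    | zero => simp [chooseT]
    | succ r => simp [chooseT]; omega
  | cons a l ih =>
    cases r with
    | zero => simp [chooseT]; omega
    | succ r =>
      simp only [chooseT, Timed.bind_time, Timed.pure_time, tick_time, List.length_cons]
      have h1 := ih r
      have h2 := ih (r + 1)
      have h3 := length_chooseT_le r l
      have h4 := length_chooseT_le (r + 1) l
      set L := l.length
      set X := (L + 1) ^ (r + 1) with hX
      have h5 : (chooseT r l).val.length + (chooseT (r + 1) l).val.length ≤ X := by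
        have h3 : L ^ r ≤ (L + 1) ^ r := Nat.pow_le_pow_left (by omega) r
        calc _ ≤ L ^ r + L ^ (r + 1) := by omega
          _ = (L + 1) * L ^ r := by ring
          _ ≤ (L + 1) * (L + 1) ^ r := Nat.mul_le_mul_left _ h3
          _ = _ := by rw [hX]; ring
      have h6 : 1 ≤ X := Nat.one_le_pow _ _ (by omega)
      have h7 : (L + 1) ^ (r + 2) + 2 * X ≤ (L + 2) ^ (r + 2) := by
        have h8 : (L + 1) ^ r ≤ (L + 2) ^ r := Nat.pow_le_pow_left (by omega) r
        have e1 : (L + 1) ^ (r + 2) + 2 * X = ((L + 1) * (L + 3)) * (L + 1) ^ r := by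
          rw [hX]; ring
        have e2 : (L + 2) ^ (r + 2) = ((L + 2) * (L + 2)) * (L + 2) ^ r := by ring
        rw [e1, e2]
        exact Nat.mul_le_mul (by nlinarith) h8
      have h9 : (r + 2) * ((chooseT r l).val.length + (chooseT (r + 1) l).val.length) ≤
        (r + 2) * X := Nat.mul_le_mul_left _ h5
      have h10 : 2 * (r + 3) * ((L + 1) ^ (r + 2) + 2 * X) ≤ 2 * (r + 3) * (L + 2) ^ (r + 2) :=
        Nat.mul_le_mul_left _ h7
      have e3 : 2 * (r + 1 + 2) * (L + 1 + 1) ^ (r + 1 + 1) = 2 * (r + 3) * (L + 2) ^ (r + 2) := by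
        ring
      have e4 : 2 * (r + 1 + 2) * (L + 1) ^ (r + 1 + 1) = 2 * (r + 3) * (L + 1) ^ (r + 2) := by
        ring
      rw [e4] at h2
      rw [e3]
      nlinarith

theorem findT_val_none {α β : Type} (f : α → Timed (Option β)) (l : List α) :
    (findT f l).val = none ↔ ∀ a ∈ l, (f a).val = none := by
  induction l with
  | nil => simp [findT]
  | cons a l ih =>
    simp only [findT, Timed.bind_val, List.mem_cons, forall_eq_or_imp]
    cases h : (f a).val with
    | none => simp [ih]
    | some b => simp

theorem findT_val_some {α β : Type} (f : α → Timed (Option β)) (l : List α) (b : β)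
    (h : (findT f l).val = some b) : ∃ a ∈ l, (f a).val = some b := by
  induction l with
  | nil => simp [findT] at h
  | cons a l ih =>
    simp only [findT, Timed.bind_val] at h
    cases h' : (f a).val with
    | none =>
      rw [h'] at h
      obtain ⟨a', ha', h''⟩ := ih h
      exact ⟨a', List.mem_cons_of_mem _ ha', h''⟩
    | some b' =>
      rw [h'] at h
      exact ⟨a, List.mem_cons_self, by rw [h']; exact h⟩

theorem findT_time_le {α β : Type} (f : α → Timed (Option β)) (l : List α) (T : ℕ)
    (h : ∀ a ∈ l, (f a).time ≤ T) : (findT f l).time ≤ l.length * (T + 1) + 1 := by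
  induction l with
  | nil => simp [findT]
  | cons a l ih =>
    simp only [findT, Timed.bind_time, tick_time, List.length_cons]
    have h1 := h a List.mem_cons_self
    have h2 := ih fun a' ha' => h a' (List.mem_cons_of_mem _ ha')
    have h3 : (l.length + 1) * (T + 1) = l.length * (T + 1) + (T + 1) := by ring
    cases (f a).val with
    | none => dsimp only; omega
    | some b => simp only [Timed.pure_time]; omega

theorem sumT_val {α : Type} (f : α → Timed ℕ) (l : List α) :
    (sumT f l).val = (l.map fun a => (f a).val).sum := by
  induction l with
  | nil => simp [sumT]
  | cons a l ih =>
    simp only [sumT, Timed.bind_val, List.map_cons, List.sum_cons, ← ih]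
    rfl

/-- Summands and partial sums never exceed the total, so one bound on its length covers every
addition. -/
theorem sumT_time_le {α : Type} (f : α → Timed ℕ) (l : List α) (T Y : ℕ)
    (h : ∀ a ∈ l, (f a).time ≤ T) (hY : (sumT f l).val.size ≤ Y) :
    (sumT f l).time ≤ l.length * (T + 2 * Y + 1) + 1 := by
  induction l with
  | nil => simp [sumT]
  | cons a l ih =>
    have hval : (sumT f (a :: l)).val = (f a).val + (sumT f l).val := rfl
    have htime : (sumT f (a :: l)).time = (f a).time + ((sumT f l).time +
      ((f a).val.size + (sumT f l).val.size + 1)) := rfl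
    rw [hval] at hY
    have h1 : (f a).val.size ≤ Y := (Nat.size_le_size (by omega)).trans hY
    have h2 : (sumT f l).val.size ≤ Y := (Nat.size_le_size (by omega)).trans hY
    have h3 := h a List.mem_cons_self
    have h4 := ih (fun a' ha' => h a' (List.mem_cons_of_mem _ ha')) h2
    rw [htime, List.length_cons]
    have h5 : (l.length + 1) * (T + 2 * Y + 1) = l.length * (T + 2 * Y + 1) + (T + 2 * Y + 1) := by
      ring
    omega

section

variable {n m : ℕ} (w : Fin n → Fin m → ℕ)

theorem nearestT_val (j : Fin n) (l : List (Fin m)) (hl : l ≠ []) :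
    (∃ i ∈ l, (nearestT w j l).val = w j i) ∧ ∀ i ∈ l, (nearestT w j l).val ≤ w j i := by
  induction l with
  | nil => exact absurd rfl hl
  | cons a l ih =>
    cases l with
    | nil =>
      have : (nearestT w j [a]).val = w j a := rfl
      simp [this]
    | cons b l =>
      obtain ⟨⟨i, hi, h1⟩, h2⟩ := ih (by simp)
      have hval : (nearestT w j (a :: b :: l)).val =
        min (w j a) (nearestT w j (b :: l)).val := rfl
      rw [hval]
      constructor
      · rcases min_choice (w j a) (nearestT w j (b :: l)).val with h | h
        · exact ⟨a, List.mem_cons_self, h⟩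
        · exact ⟨i, List.mem_cons_of_mem _ hi, h.trans h1⟩
      · intro i' hi'
        rcases List.mem_cons.1 hi' with rfl | hi'
        · exact min_le_left _ _
        · exact (min_le_right _ _).trans (h2 i' hi')

theorem size_le_inputSize (j : Fin n) (i : Fin m) : (w j i).size ≤ inputSize w := by
  have h1 := Finset.single_le_sum (f := fun i => (w j i).size + 1) (fun _ _ => Nat.zero_le _)
    (Finset.mem_univ i)
  have h2 := Finset.single_le_sum (f := fun j => ∑ i, ((w j i).size + 1))
    (fun _ _ => Nat.zero_le _) (Finset.mem_univ j)
  unfold inputSize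
  omega

theorem nearestT_val_lt (j : Fin n) (l : List (Fin m)) :
    (nearestT w j l).val < 2 ^ inputSize w := by
  rcases eq_or_ne l [] with rfl | hl
  · exact Nat.two_pow_pos _
  · obtain ⟨⟨i, -, h⟩, -⟩ := nearestT_val w j l hl
    rw [h]
    exact Nat.size_le.1 (size_le_inputSize w j i)

theorem nearestT_time_le (j : Fin n) (l : List (Fin m)) :
    (nearestT w j l).time ≤ l.length * (3 * inputSize w + 2) + 1 := by
  induction l with
  | nil => exact le_of_eq (by simp [nearestT])
  | cons a l ih =>
    have h1 := size_le_inputSize w j a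
    cases l with
    | nil =>
      have : (nearestT w j [a]).time = (w j a).size + 1 := rfl
      rw [this]
      simp
      omega
    | cons b l =>
      have htime : (nearestT w j (a :: b :: l)).time = ((w j a).size + 1) +
        ((nearestT w j (b :: l)).time + ((w j a).size + (nearestT w j (b :: l)).val.size + 1)) :=
        rfl
      have h2 : (nearestT w j (b :: l)).val.size ≤ inputSize w :=
        Nat.size_le.2 (nearestT_val_lt w j _)
      rw [htime, List.length_cons (a := a), add_mul]
      omega

theorem costT_val (l : List (Fin m)) : (costT w l).val = ∑ j, (nearestT w j l).val := by
  rw [Fin.sum_univ_def, ← sumT_val]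
  rfl

theorem costT_val_lt (l : List (Fin m)) : (costT w l).val < 2 ^ (2 * inputSize w) := by
  have hn : n < 2 ^ inputSize w :=
    lt_of_le_of_lt (by unfold inputSize; omega) (Nat.lt_two_pow_self (n := inputSize w))
  calc (costT w l).val ≤ ∑ _j : Fin n, 2 ^ inputSize w := by
        rw [costT_val]
        exact Finset.sum_le_sum fun j _ => (nearestT_val_lt w j l).le
    _ = n * 2 ^ inputSize w := by simp
    _ < 2 ^ inputSize w * 2 ^ inputSize w := Nat.mul_lt_mul_of_pos_right hn (Nat.two_pow_pos _)
    _ = _ := by rw [← pow_add, two_mul]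

theorem costT_time_le (l : List (Fin m)) (hI : 1 ≤ inputSize w) (hl : l.length ≤ 2 * inputSize w) :
    (costT w l).time ≤ 18 * inputSize w ^ 3 := by
  set I := inputSize w with hIdef
  have hn : n ≤ I := by rw [hIdef]; unfold inputSize; omega
  have hnear : ∀ j, (nearestT w j l).time ≤ 11 * I ^ 2 := by
    intro j
    have h1 := nearestT_time_le w j l
    have h2 : l.length * (3 * I + 2) ≤ 2 * I * (3 * I + 2) := Nat.mul_le_mul_right _ hl
    rw [← hIdef] at h1
    nlinarith
  have h1 : (sumT (fun j => nearestT w j l) (List.finRange n)).time ≤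
      (List.finRange n).length * (11 * I ^ 2 + 2 * (2 * I) + 1) + 1 :=
    sumT_time_le _ _ _ _ (fun j _ => hnear j) (Nat.size_le.2 (costT_val_lt w l))
  have h2 : (costT w l).time = n + (sumT (fun j => nearestT w j l) (List.finRange n)).time := rfl
  rw [List.length_finRange] at h1
  have h3 : n * (11 * I ^ 2 + 2 * (2 * I) + 1) ≤ I * (11 * I ^ 2 + 2 * (2 * I) + 1) :=
    Nat.mul_le_mul_right _ hn
  have h4 : I ^ 2 ≤ I ^ 3 := Nat.pow_le_pow_right hI (by omega)
  have h5 : I ≤ I ^ 3 := Nat.le_self_pow (by omega) I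
  have h6 : I * (11 * I ^ 2 + 2 * (2 * I) + 1) = 11 * I ^ 3 + 4 * I ^ 2 + I := by ring
  omega

end

/-! ### One round of the local search. -/

section

variable {n m : ℕ} (w : Fin n → Fin m → ℕ)

/-- The test of a single swap in `improveT`. -/
def trySwapT (M bound : ℕ) (S Q P : List (Fin m)) : Timed (Option (List (Fin m))) := do
  let kept ← diffT S Q
  tick (kept.length + P.length + 1)
  let S' := kept ++ P
  let c' ← costT w S'
  let scaled ← mulT M c'
  if ← ltT scaled bound then pure (some S') else pure none

/-- The test of all swaps of a given size in `improveT`. -/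
def trySizeT (M bound : ℕ) (S out : List (Fin m)) (r : ℕ) : Timed (Option (List (Fin m))) := do
  let Qs ← chooseT r S
  let Ps ← chooseT r out
  findT (fun Q => findT (fun P => trySwapT w M bound S Q P) Ps) Qs

/-- The candidates outside `S`. -/
def outside (S : List (Fin m)) : List (Fin m) := (List.finRange m).filter fun i => i ∉ S

/-- The solution after a swap. -/
def swapped (S Q P : List (Fin m)) : List (Fin m) := (S.filter fun i => i ∉ Q) ++ P

theorem trySwapT_val (M bound : ℕ) (S Q P : List (Fin m)) :
    (trySwapT w M bound S Q P).val =
      if M * (costT w (swapped S Q P)).val < bound then some (swapped S Q P) else none := by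
  have : (trySwapT w M bound S Q P).val =
      (if decide (M * (costT w (swapped S Q P)).val < bound) = true then
        (pure (some (swapped S Q P)) : Timed (Option (List (Fin m)))) else pure none).val := rfl
  rw [this]
  split_ifs with h1 h2 h2
  · rfl
  · exact absurd (of_decide_eq_true h1) h2
  · exact absurd (decide_eq_true h2) h1
  · rfl

theorem improveT_val (ρ N : ℕ) (S : List (Fin m)) :
    (improveT w ρ N S).val = (findT (fun r => trySizeT w (N * S.length)
      ((N * S.length - 1) * (costT w S).val) S (outside S) r) (List.range (ρ + 1))).val := rfl

theorem improveT_none {ρ N : ℕ} {S : List (Fin m)} (h : (improveT w ρ N S).val = none) (r : ℕ)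
    (hr : r ≤ ρ) {Q P : List (Fin m)} (hQ : Q.Sublist S) (hQr : Q.length = r)
    (hP : P.Sublist (outside S)) (hPr : P.length = r) :
    (N * S.length - 1) * (costT w S).val ≤ N * S.length * (costT w (swapped S Q P)).val := by
  rw [improveT_val, findT_val_none] at h
  have h1 := h r (List.mem_range.2 (by omega))
  have h2 : (trySizeT w (N * S.length) ((N * S.length - 1) * (costT w S).val) S (outside S) r).val =
    (findT (fun Q => findT (fun P => trySwapT w (N * S.length)
      ((N * S.length - 1) * (costT w S).val) S Q P) (chooseT r (outside S)).val)
      (chooseT r S).val).val := rfl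
  rw [h2, findT_val_none] at h1
  have h3 := h1 Q ((mem_chooseT r S Q).2 ⟨hQ, hQr⟩)
  rw [findT_val_none] at h3
  have h4 := h3 P ((mem_chooseT r _ P).2 ⟨hP, hPr⟩)
  rw [trySwapT_val] at h4
  by_contra! hlt
  rw [if_pos hlt] at h4
  exact absurd h4 (by simp)

theorem improveT_some {ρ N : ℕ} {S S' : List (Fin m)} (h : (improveT w ρ N S).val = some S') :
    ∃ Q P : List (Fin m), Q.Sublist S ∧ P.Sublist (outside S) ∧ P.length = Q.length ∧
      S' = swapped S Q P ∧
      N * S.length * (costT w S').val < (N * S.length - 1) * (costT w S).val := by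
  rw [improveT_val] at h
  obtain ⟨r, -, h1⟩ := findT_val_some _ _ _ h
  have h2 : (trySizeT w (N * S.length) ((N * S.length - 1) * (costT w S).val) S (outside S) r).val =
    (findT (fun Q => findT (fun P => trySwapT w (N * S.length)
      ((N * S.length - 1) * (costT w S).val) S Q P) (chooseT r (outside S)).val)
      (chooseT r S).val).val := rfl
  rw [h2] at h1
  obtain ⟨Q, hQ, h3⟩ := findT_val_some _ _ _ h1
  obtain ⟨P, hP, h4⟩ := findT_val_some _ _ _ h3
  rw [mem_chooseT] at hQ hP
  rw [trySwapT_val] at h4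
  split_ifs at h4 with hlt
  have h5 := Option.some_injective _ h4
  exact ⟨Q, P, hQ.1, hP.1, hP.2.trans hQ.2.symm, h5.symm, h5 ▸ hlt⟩

theorem nodup_outside (S : List (Fin m)) : (outside S).Nodup := (List.nodup_finRange m).filter _

theorem notMem_of_mem_outside {S : List (Fin m)} {i : Fin m} (h : i ∈ outside S) : i ∉ S := by
  simpa [outside] using h

theorem toFinset_swapped (S Q P : List (Fin m)) :
    (swapped S Q P).toFinset = (S.toFinset \ Q.toFinset) ∪ P.toFinset := by
  ext i
  simp [swapped]

theorem length_filter_notMem {S Q : List (Fin m)} (hS : S.Nodup) (hQ : Q.Sublist S) :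
    (S.filter fun i => i ∉ Q).length + Q.length = S.length := by
  rw [← List.toFinset_card_of_nodup (hS.filter _), ← List.toFinset_card_of_nodup (hS.sublist hQ),
    ← List.toFinset_card_of_nodup hS]
  have h1 : (S.filter fun i => i ∉ Q).toFinset = S.toFinset \ Q.toFinset := by
    ext i
    simp
  rw [h1]
  refine Finset.card_sdiff_add_card_eq_card fun i hi => ?_
  rw [List.mem_toFinset] at hi ⊢
  exact hQ.subset hi

theorem swapped_nodup {S Q P : List (Fin m)} (hS : S.Nodup) (hP : P.Sublist (outside S)) :
    (swapped S Q P).Nodup := by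
  refine (hS.filter _).append ((nodup_outside S).sublist hP) ?_
  intro i hi hi'
  exact notMem_of_mem_outside (hP.subset hi') (List.mem_of_mem_filter hi)

theorem length_swapped {S Q P : List (Fin m)} (hS : S.Nodup) (hQ : Q.Sublist S)
    (hPQ : P.length = Q.length) : (swapped S Q P).length = S.length := by
  have := length_filter_notMem hS hQ
  unfold swapped
  rw [List.length_append]
  omega

theorem mul_mul_size_lt {M c I N : ℕ} (hM : M ≤ N * I) (hc : c < 2 ^ (2 * I)) :
    (M * c).size ≤ (N + 2) * I := by
  rw [Nat.size_le]
  calc M * c ≤ (N * I) * c := Nat.mul_le_mul_right _ hM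
    _ ≤ 2 ^ (N * I) * c := Nat.mul_le_mul_right _ Nat.lt_two_pow_self.le
    _ < 2 ^ (N * I) * 2 ^ (2 * I) := Nat.mul_lt_mul_of_pos_left hc (Nat.two_pow_pos _)
    _ = 2 ^ ((N + 2) * I) := by rw [← pow_add]; congr 1; ring

theorem mulT_time_le {M c I N : ℕ} (hI : 1 ≤ I) (hM : M ≤ N * I) (hc : c < 2 ^ (2 * I)) :
    (mulT M c).time ≤ 3 * (N + 1) * I ^ 2 := by
  have h1 : M.size ≤ N * I := Nat.size_le.2 (lt_of_le_of_lt hM Nat.lt_two_pow_self)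
  have h2 : c.size ≤ 2 * I := Nat.size_le.2 hc
  calc (mulT M c).time = (M.size + 1) * (c.size + 1) := rfl
    _ ≤ (N * I + 1) * (2 * I + 1) := Nat.mul_le_mul (by omega) (by omega)
    _ ≤ (N * I + I) * (2 * I + I) := Nat.mul_le_mul (by omega) (by omega)
    _ = _ := by ring

theorem trySwapT_time_le {I N ρ M c : ℕ} {S Q P : List (Fin m)} (hI : I = inputSize w)
    (hI1 : 1 ≤ I) (hM : M ≤ N * I) (hc : c < 2 ^ (2 * I)) (hS : S.length ≤ I)
    (hQ : Q.length ≤ ρ) (hP : P.length ≤ I) :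
    (trySwapT w M ((M - 1) * c) S Q P).time ≤ (2 * ρ + 5 * N + 50) * I ^ 3 := by
  have htime : (trySwapT w M ((M - 1) * c) S Q P).time = (S.length + 1) * (Q.length + 1) +
      (((S.filter fun i => i ∉ Q).length + P.length + 1) + ((costT w (swapped S Q P)).time +
        ((mulT M (costT w (swapped S Q P)).val).time +
          (((M * (costT w (swapped S Q P)).val).size + ((M - 1) * c).size + 1) +
            (if decide (M * (costT w (swapped S Q P)).val < (M - 1) * c) = true then
              (pure (some (swapped S Q P)) : Timed (Option (List (Fin m)))) else pure none).time)))) :=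
    rfl
  have h0 : (if decide (M * (costT w (swapped S Q P)).val < (M - 1) * c) = true then
      (pure (some (swapped S Q P)) : Timed (Option (List (Fin m)))) else pure none).time = 0 := by
    split_ifs <;> rfl
  have h1 : (S.filter fun i => i ∉ Q).length ≤ S.length := List.length_filter_le _ _
  have hlen : (swapped S Q P).length ≤ 2 * I := by
    unfold swapped
    rw [List.length_append]
    omega
  have h2 : (costT w (swapped S Q P)).time ≤ 18 * I ^ 3 := by
    rw [hI] at hI1 hlen ⊢
    exact costT_time_le w _ hI1 hlen
  have hc' : (costT w (swapped S Q P)).val < 2 ^ (2 * I) := by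
    rw [hI]
    exact costT_val_lt w _
  have h3 := mulT_time_le hI1 hM hc'
  have h4 := mul_mul_size_lt hM hc'
  have h5 := mul_mul_size_lt (show M - 1 ≤ N * I by omega) hc
  have h6 : (S.length + 1) * (Q.length + 1) ≤ (2 * I) * (ρ + 1) :=
    Nat.mul_le_mul (by omega) (by omega)
  rw [htime, h0]
  have h7 : I ≤ I ^ 3 := Nat.le_self_pow (by omega) I
  have h8 : I ^ 2 ≤ I ^ 3 := Nat.pow_le_pow_right hI1 (by omega)
  calc _ ≤ (2 * I) * (ρ + 1) + (2 * I + I) + 18 * I ^ 3 + 3 * (N + 1) * I ^ 2 +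
        ((N + 2) * I + (N + 2) * I + I) := by omega
    _ = (2 * ρ + 2 + 3 + 2 * N + 5) * I + 18 * I ^ 3 + 3 * (N + 1) * I ^ 2 := by ring
    _ ≤ (2 * ρ + 2 + 3 + 2 * N + 5) * I ^ 3 + 18 * I ^ 3 + 3 * (N + 1) * I ^ 3 := by gcongr
    _ = (2 * ρ + 5 * N + 31) * I ^ 3 := by ring
    _ ≤ _ := by gcongr; omega

theorem findT_time_le_pow {α β : Type} (f : α → Timed (Option β)) (l : List α) {I C a b : ℕ}
    (hI : 1 ≤ I) (hl : l.length ≤ I ^ a) (h : ∀ x ∈ l, (f x).time ≤ C * I ^ b) :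
    (findT f l).time ≤ (C + 2) * I ^ (a + b) := by
  have h1 := findT_time_le f l _ h
  have h2 : 1 ≤ I ^ b := Nat.one_le_pow _ _ hI
  have h3 : 1 ≤ I ^ (a + b) := Nat.one_le_pow _ _ hI
  calc _ ≤ l.length * (C * I ^ b + 1) + 1 := h1
    _ ≤ I ^ a * (C * I ^ b + I ^ b) + I ^ (a + b) := by gcongr
    _ = _ := by ring

/-- One round of the local search takes polynomial time. -/
theorem exists_improveT_time_le (ρ N : ℕ) : ∃ C : ℕ, ∀ {n m : ℕ} (w : Fin n → Fin m → ℕ)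
    (S : List (Fin m)), 1 ≤ m → S.length ≤ m →
    (improveT w ρ N S).time ≤ C * inputSize w ^ (2 * ρ + 3) := by
  -- The summands pay for setup, `N * k`, the current cost, the threshold, the list of outside
  -- candidates, and the search over `ρ + 1` swap sizes. In the exponent, `2 * ρ` counts pairs of
  -- sublists and 3 comes from evaluating a cost.
  refine ⟨ρ + 3 + 2 * (N + 1) + 18 + 3 * (N + 1) + 4 + ((ρ + 1) * (2 * ρ + 5 * N + 54 +
    2 * (2 * (ρ + 2) * 2 ^ (ρ + 1)) + 1) + 1), ?_⟩
  intro n m w S hm hS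
  set I := inputSize w with hI
  have hmI : m ≤ I := by rw [hI]; unfold inputSize; omega
  have hI1 : 1 ≤ I := by omega
  have hSI : S.length ≤ I := by omega
  have hM : N * S.length ≤ N * I := Nat.mul_le_mul_left _ hSI
  have hc : (costT w S).val < 2 ^ (2 * I) := costT_val_lt w S
  have hout : (outside S).length ≤ I := by
    have : (outside S).length ≤ (List.finRange m).length := List.length_filter_le _ _
    rw [List.length_finRange] at this
    omega
  have hchoose : ∀ (l : List (Fin m)) (r : ℕ), l.length ≤ I → r ≤ ρ →
      (chooseT r l).time ≤ (2 * (ρ + 2) * 2 ^ (ρ + 1)) * I ^ (2 * ρ + 3) := by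
    intro l r hl hr
    calc _ ≤ 2 * (r + 2) * (l.length + 1) ^ (r + 1) := chooseT_time_le r l
      _ ≤ 2 * (ρ + 2) * (2 * I) ^ (r + 1) := by gcongr; omega
      _ ≤ 2 * (ρ + 2) * (2 * I) ^ (ρ + 1) := by gcongr; omega
      _ = (2 * (ρ + 2) * 2 ^ (ρ + 1)) * I ^ (ρ + 1) := by rw [mul_pow]; ring
      _ ≤ _ := by gcongr <;> omega
  have hnum : ∀ (l : List (Fin m)) (r : ℕ), l.length ≤ I → r ≤ ρ →
      (chooseT r l).val.length ≤ I ^ ρ := by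
    intro l r hl hr
    calc _ ≤ l.length ^ r := length_chooseT_le r l
      _ ≤ I ^ r := Nat.pow_le_pow_left hl r
      _ ≤ I ^ ρ := Nat.pow_le_pow_right hI1 hr
  have hsize : ∀ r ∈ List.range (ρ + 1), (trySizeT w (N * S.length)
      ((N * S.length - 1) * (costT w S).val) S (outside S) r).time ≤
      (2 * ρ + 5 * N + 54 + 2 * (2 * (ρ + 2) * 2 ^ (ρ + 1))) * I ^ (2 * ρ + 3) := by
    intro r hr
    have hr : r ≤ ρ := by have := List.mem_range.1 hr; omega
    have htime : (trySizeT w (N * S.length)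
      ((N * S.length - 1) * (costT w S).val) S (outside S) r).time = (chooseT r S).time +
      ((chooseT r (outside S)).time + (findT (fun Q => findT (fun P => trySwapT w (N * S.length)
      ((N * S.length - 1) * (costT w S).val) S Q P) (chooseT r (outside S)).val)
      (chooseT r S).val).time) := rfl
    have h1 : (findT (fun Q => findT (fun P => trySwapT w (N * S.length)
        ((N * S.length - 1) * (costT w S).val) S Q P) (chooseT r (outside S)).val)
        (chooseT r S).val).time ≤ (2 * ρ + 5 * N + 50 + 2 + 2) * I ^ (ρ + (ρ + 3)) := by
      refine findT_time_le_pow _ _ hI1 (hnum S r hSI hr) fun Q hQ => ?_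
      refine findT_time_le_pow _ _ hI1 (hnum _ r hout hr) fun P hP => ?_
      rw [mem_chooseT] at hQ hP
      refine trySwapT_time_le w hI hI1 hM hc hSI (by omega) ?_
      have := hP.1.length_le
      omega
    have e1 : ρ + (ρ + 3) = 2 * ρ + 3 := by ring
    rw [e1] at h1
    have h2 := hchoose S r hSI hr
    have h3 := hchoose (outside S) r hout hr
    rw [htime]
    calc _ ≤ (2 * (ρ + 2) * 2 ^ (ρ + 1)) * I ^ (2 * ρ + 3) +
        ((2 * (ρ + 2) * 2 ^ (ρ + 1)) * I ^ (2 * ρ + 3) +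
          (2 * ρ + 5 * N + 50 + 2 + 2) * I ^ (2 * ρ + 3)) := by gcongr
      _ = _ := by ring
  have hfind := findT_time_le (fun r => trySizeT w (N * S.length)
      ((N * S.length - 1) * (costT w S).val) S (outside S) r) _ _ hsize
  rw [List.length_range] at hfind
  have htime : (improveT w ρ N S).time = (m + S.length + ρ + 1) + ((mulT N S.length).time +
      ((costT w S).time + ((mulT (N * S.length - 1) (costT w S).val).time +
        ((List.finRange m).length + 1) * (S.length + 1) +
        (findT (fun r => trySizeT w (N * S.length)
          ((N * S.length - 1) * (costT w S).val) S (outside S) r) (List.range (ρ + 1))).time))) := by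
    have : (improveT w ρ N S).time = (m + S.length + ρ + 1) + ((mulT N S.length).time +
      ((costT w S).time + ((mulT (N * S.length - 1) (costT w S).val).time +
        (((List.finRange m).length + 1) * (S.length + 1) +
        (findT (fun r => trySizeT w (N * S.length)
          ((N * S.length - 1) * (costT w S).val) S (outside S) r) (List.range (ρ + 1))).time)))) := rfl
    rw [this]
    ring
  have h1 : (mulT N S.length).time ≤ 2 * (N + 1) * I := by
    have h2 : N.size ≤ N := Nat.size_le.2 Nat.lt_two_pow_self
    have h3 : S.length.size ≤ I := Nat.size_le.2 (lt_of_le_of_lt hSI Nat.lt_two_pow_self)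
    calc _ = (N.size + 1) * (S.length.size + 1) := rfl
      _ ≤ (N + 1) * (2 * I) := Nat.mul_le_mul (by omega) (by omega)
      _ = _ := by ring
  have h2 := costT_time_le w S hI1 (by omega)
  have h3 := mulT_time_le hI1 (show N * S.length - 1 ≤ N * I by omega) hc
  have h4 : ((List.finRange m).length + 1) * (S.length + 1) ≤ 4 * I ^ 2 := by
    rw [List.length_finRange]
    calc _ ≤ (2 * I) * (2 * I) := Nat.mul_le_mul (by omega) (by omega)
      _ = _ := by ring
  set T := I ^ (2 * ρ + 3) with hT
  have p1 : I ≤ T := Nat.le_self_pow (by omega) I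
  have p2 : I ^ 2 ≤ T := Nat.pow_le_pow_right hI1 (by omega)
  have p3 : I ^ 3 ≤ T := Nat.pow_le_pow_right hI1 (by omega)
  have p0 : 1 ≤ T := by omega
  set D := 2 * ρ + 5 * N + 54 + 2 * (2 * (ρ + 2) * 2 ^ (ρ + 1)) with hD
  rw [← hI] at h2
  rw [htime]
  calc _ ≤ (2 * I + (ρ + 1) * 1) + (2 * (N + 1) * I + (18 * I ^ 3 + (3 * (N + 1) * I ^ 2 +
        4 * I ^ 2 + ((ρ + 1) * (D * T + 1) + 1)))) :=
        add_le_add (by omega) (add_le_add h1 (add_le_add h2 (add_le_add (add_le_add h3 h4) hfind)))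
    _ ≤ (2 * T + (ρ + 1) * T) + (2 * (N + 1) * T + (18 * T + (3 * (N + 1) * T +
        4 * T + ((ρ + 1) * (D * T + T) + T)))) := by gcongr
    _ = _ := by ring

end

/-! ### The number of rounds. -/

section

variable {n m : ℕ} (w : Fin n → Fin m → ℕ)

/-- The local search halts after a number of rounds that is logarithmic in the initial cost. -/
theorem exists_runs {ρ N k X : ℕ}
    (hX : ∀ S : List (Fin m), S.Nodup → S.length = k → (improveT w ρ N S).time ≤ X) (b : ℕ)
    (S : List (Fin m)) (hS : S.Nodup) (hSk : S.length = k)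
    (hb : (N * k : ℕ) * Real.log (costT w S).val ≤ b) :
    ∃ R t, Runs w ρ N S R t ∧ t ≤ (b + 2) * X ∧ R.Nodup ∧ R.length = k ∧
      (improveT w ρ N R).val = none := by
  induction b generalizing S with
  | zero =>
    cases h : (improveT w ρ N S).val with
    | none => exact ⟨S, _, Runs.halt S h, (hX S hS hSk).trans (by omega), hS, hSk, h⟩
    | some S' =>
      obtain ⟨Q, P, hQ, hP, hPQ, rfl, hlt⟩ := improveT_some w h
      have h1 := swapped_nodup hS hP (Q := Q)
      have h2 := (length_swapped hS hQ hPQ).trans hSk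
      -- With no potential left the cost is an integer at most 1, so an improvement makes it 0 and a
      -- further one is impossible. This accounts for the extra 2 in the number of rounds.
      have h3 : (improveT w ρ N (swapped S Q P)).val = none := by
        rw [hSk] at hlt
        have hM : 1 ≤ N * k := by
          by_contra! h0
          have : N * k = 0 := by omega
          rw [this] at hlt
          simp at hlt
        have hM' : (1 : ℝ) ≤ (N * k : ℕ) := by exact_mod_cast hM
        have hc1 : (costT w S).val ≤ 1 := by
          by_contra! h0
          have h4 : 0 < Real.log (costT w S).val := Real.log_pos (by exact_mod_cast h0)
          have h5 : (0 : ℝ) < (N * k : ℕ) * Real.log (costT w S).val := by positivity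
          push_cast at hb h5
          linarith
        have hc0 : (costT w (swapped S Q P)).val = 0 := by
          by_contra h0
          have h4 : N * k * 1 ≤ N * k * (costT w (swapped S Q P)).val :=
            Nat.mul_le_mul_left _ (by omega)
          have h5 : (N * k - 1) * (costT w S).val ≤ (N * k - 1) * 1 := Nat.mul_le_mul_left _ hc1
          omega
        cases h' : (improveT w ρ N (swapped S Q P)).val with
        | none => rfl
        | some S'' =>
          obtain ⟨_, _, -, -, -, -, hlt'⟩ := improveT_some w h'
          rw [hc0, Nat.mul_zero] at hlt'
          exact absurd hlt' (Nat.not_lt_zero _)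
      refine ⟨_, _, Runs.step _ _ _ _ h (Runs.halt _ h3), ?_, h1, h2, h3⟩
      have := hX _ hS hSk
      have := hX _ h1 h2
      omega
  | succ b ih =>
    cases h : (improveT w ρ N S).val with
    | none =>
      exact ⟨S, _, Runs.halt S h, (hX S hS hSk).trans (Nat.le_mul_of_pos_left _ (by omega)),
        hS, hSk, h⟩
    | some S' =>
      obtain ⟨Q, P, hQ, hP, hPQ, rfl, hlt⟩ := improveT_some w h
      have h1 := swapped_nodup hS hP (Q := Q)
      have h2 := (length_swapped hS hQ hPQ).trans hSk
      rw [hSk] at hlt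
      obtain ⟨R, t, hR, ht, h3, h4, h5⟩ := ih _ h1 h2 (by
        set c := (costT w S).val
        set c' := (costT w (swapped S Q P)).val
        -- A zero cost needs no argument since `Real.log 0 = 0`. Otherwise `log (1 - 1 / M) ≤ -1 /
        -- M` shows that `M * log c` drops by at least one.
        rcases Nat.eq_zero_or_pos c' with h0 | h0
        · rw [h0]; simp
        have hM : 1 ≤ N * k := by
          by_contra! h0
          have : N * k = 0 := by omega
          rw [this] at hlt
          simp at hlt
        set M := N * k
        have hM' : (1 : ℝ) ≤ M := by exact_mod_cast hM
        have hc' : (0 : ℝ) < c' := by exact_mod_cast h0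
        have hltR : (M : ℝ) * c' < (M - 1) * c := by
          have : ((M * c' : ℕ) : ℝ) < ((M - 1) * c : ℕ) := Nat.cast_lt.2 hlt
          rwa [Nat.cast_mul M c', Nat.cast_mul (M - 1) c, Nat.cast_sub hM, Nat.cast_one] at this
        have hc : (0 : ℝ) < c := by
          rcases Nat.eq_zero_or_pos c with h6 | h6
          · rw [h6, Nat.mul_zero] at hlt
            exact absurd hlt (Nat.not_lt_zero _)
          · exact_mod_cast h6
        have h6 : (c' : ℝ) / c ≤ 1 - 1 / M := by
          have e1 : (1 : ℝ) - 1 / M = (M - 1) / M := by field_simp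
          rw [e1, div_le_div_iff₀ hc (by linarith)]
          linarith
        have h7 := Real.log_le_sub_one_of_pos (div_pos hc' hc)
        rw [Real.log_div hc'.ne' hc.ne'] at h7
        have h8 : Real.log c' ≤ Real.log c - 1 / M := by linarith
        have h9 : M * Real.log c' ≤ M * (Real.log c - 1 / M) := by gcongr
        have e2 : (M : ℝ) * (Real.log c - 1 / M) = M * Real.log c - 1 := by
          field_simp
        push_cast at hb
        linarith)
      refine ⟨R, _, Runs.step _ _ _ _ h hR, ?_, h3, h4, h5⟩
      have h6 := hX _ hS hSk
      calc _ ≤ X + (b + 2) * X := add_le_add h6 ht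
        _ = _ := by ring

end

/-- Polynomial running time of the local search. -/
theorem exists_runs_le (ρ N : ℕ) : ∃ A : ℕ, ∀ {n m : ℕ} (w : Fin n → Fin m → ℕ)
    (S : List (Fin m)), S.Nodup → S ≠ [] → ∃ R t, Runs w ρ N S R t ∧
      t ≤ A * inputSize w ^ (5 * (ρ + 1)) ∧ R.Nodup ∧ R.length = S.length ∧
      (improveT w ρ N R).val = none := by
  obtain ⟨C, hC⟩ := exists_improveT_time_le ρ N
  refine ⟨(2 * N + 2) * C, fun {n m} w S hS hne => ?_⟩
  have hlen : ∀ S : List (Fin m), S.Nodup → S.length ≤ m := fun S hS => by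
    simpa using hS.length_le_card
  have hS1 : 1 ≤ S.length := List.length_pos_of_ne_nil hne
  have hSm := hlen S hS
  set I := inputSize w with hI
  have hmI : m ≤ I := by rw [hI]; unfold inputSize; omega
  have hI1 : 1 ≤ I := by omega
  -- Costs are below `2 ^ (2 * I)` and `k ≤ I`, so the initial potential is at most `2 * N * I ^ 2`.
  -- This adds 2 to the exponent of one round, and `2 * ρ + 5 ≤ 5 * (ρ + 1)`.
  obtain ⟨R, t, h1, h2, h3, h4, h5⟩ := exists_runs w (ρ := ρ) (N := N) (k := S.length)
    (fun T hT _ => hC w T (by omega) (hlen T hT)) (N * I * (2 * I)) S hS rfl (by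
      have h1 : Real.log (costT w S).val ≤ 2 * I := by
        rcases Nat.eq_zero_or_pos (costT w S).val with h0 | h0
        · rw [h0]; simp
        have h2 : ((costT w S).val : ℝ) ≤ 2 ^ (2 * I) := by
          exact_mod_cast (costT_val_lt w S).le
        have h3 : Real.log (costT w S).val ≤ Real.log (2 ^ (2 * I)) :=
          Real.log_le_log (by exact_mod_cast h0) h2
        rw [Real.log_pow] at h3
        have h4 : Real.log 2 ≤ 1 := by
          have := Real.log_le_sub_one_of_pos (show (0 : ℝ) < 2 by norm_num)
          linarith
        have h5 : ((2 * I : ℕ) : ℝ) * Real.log 2 ≤ (2 * I : ℕ) * 1 := by gcongr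
        push_cast at h3 h5
        linarith
      have h2 : ((N * S.length : ℕ) : ℝ) ≤ (N * I : ℕ) := by
        exact_mod_cast Nat.mul_le_mul_left N (hSm.trans hmI)
      calc ((N * S.length : ℕ) : ℝ) * Real.log (costT w S).val
          ≤ (N * S.length : ℕ) * (2 * I) := by gcongr
        _ ≤ (N * I : ℕ) * (2 * I) := by gcongr
        _ = _ := by push_cast; ring)
  refine ⟨R, t, h1, h2.trans ?_, h3, h4, h5⟩
  calc (N * I * (2 * I) + 2) * (C * I ^ (2 * ρ + 3))
      ≤ (N * I * (2 * I) + 2 * I ^ 2) * (C * I ^ (2 * ρ + 3)) := by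
        gcongr
        exact Nat.le_mul_of_pos_right _ (Nat.pow_pos hI1)
    _ = (2 * N + 2) * C * I ^ (2 * ρ + 5) := by ring
    _ ≤ _ := by
      gcongr
      omega

/-! ### From the distance matrix back to the metric space. -/

section

variable {V : Type u} [MetricSpace V] {n m : ℕ} {x : Fin n → V} {y : Fin m → V}

theorem cost_toFinset {w : Fin n → Fin m → ℕ} {s : ℝ} (hs : 0 < s)
    (hw : ∀ j i, dist (x j) (y i) ^ 2 = s * (w j i : ℝ)) {S : List (Fin m)} (hS : S ≠ []) :
    cost x y S.toFinset = s * ((costT w S).val : ℝ) := by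
  rw [costT_val]
  push_cast
  rw [Finset.mul_sum]
  refine Finset.sum_congr rfl fun j _ => ?_
  have hne : S.toFinset.Nonempty := by
    rwa [List.toFinset_nonempty_iff]
  obtain ⟨i, hi, h1, h2⟩ := exists_nearest (y := y) hne (x j)
  obtain ⟨⟨i', hi', h3⟩, h4⟩ := nearestT_val w j S hS
  rw [h1]
  apply le_antisymm
  · rw [h3, ← hw]
    exact pow_le_pow_left₀ dist_nonneg (h2 i' (List.mem_toFinset.2 hi')) 2
  · rw [hw]
    have := h4 i (List.mem_toFinset.1 hi)
    gcongr

theorem IsLocalOpt.mono {θ θ' ρ ρ' : ℝ} {S : Finset (Fin m)} (h : IsLocalOpt x y θ ρ S)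
    (hθ : θ ≤ θ') (hρ : ρ' ≤ ρ) : IsLocalOpt x y θ' ρ' S := by
  rintro S' ⟨P, Q, h1, h2, h3, h4, h5⟩
  refine le_trans ?_ (h S' ⟨P, Q, h1, h2, h3, h4.trans hρ, h5⟩)
  have := cost_nonneg (x := x) (y := y) S
  gcongr

/-- The local search halts at local optima with tolerance. -/
theorem isLocalOpt_of_improveT {w : Fin n → Fin m → ℕ} {s : ℝ} (hs : 0 < s)
    (hw : ∀ j i, dist (x j) (y i) ^ 2 = s * (w j i : ℝ)) {ρ : ℝ} {N : ℕ} (hN : 1 ≤ N)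
    {R : List (Fin m)} (hR : R.Nodup) (hne : R ≠ [])
    (h : (improveT w ⌊ρ⌋₊ N R).val = none) :
    IsLocalOpt x y (1 / (N * R.length)) ρ R.toFinset := by
  rintro S' ⟨P, Q, hPR, hQR, hcard, hPρ, rfl⟩
  -- The search enumerates sublists, so `Q` and `P` must be listed in the order of `R` and of
  -- `outside R`.
  set Ql := R.filter (· ∈ Q) with hQl
  set Pl := (outside R).filter (· ∈ P) with hPl
  have hQF : Ql.toFinset = Q := by
    ext i
    have : i ∈ Q → i ∈ R := fun hi => List.mem_toFinset.1 (hQR hi)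
    simp only [hQl, List.mem_toFinset, List.mem_filter, decide_eq_true_eq]
    tauto
  have hPF : Pl.toFinset = P := by
    ext i
    have : i ∈ P → i ∉ R := fun hi hi' =>
      Finset.disjoint_left.1 hPR hi (List.mem_toFinset.2 hi')
    simp only [hPl, outside, List.mem_toFinset, List.mem_filter, decide_eq_true_eq,
      List.mem_finRange, true_and]
    tauto
  have hQlen : Ql.length = Q.card := by
    rw [← List.toFinset_card_of_nodup (hR.filter _), hQF]
  have hPlen : Pl.length = P.card := by
    rw [← List.toFinset_card_of_nodup ((nodup_outside R).filter _), hPF]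
  have hQs : Ql.Sublist R := List.filter_sublist
  have hlen : (swapped R Ql Pl).length = R.length :=
    length_swapped hR hQs (by rw [hPlen, hQlen, hcard])
  have hR1 : 1 ≤ R.length := List.length_pos_of_ne_nil hne
  have hne' : swapped R Ql Pl ≠ [] := List.ne_nil_of_length_pos (by omega)
  have h1 := improveT_none w h P.card (Nat.le_floor hPρ) hQs (hQlen.trans hcard.symm)
    List.filter_sublist hPlen
  have h2 := cost_toFinset hs hw hne
  have h3 := cost_toFinset hs hw hne'
  rw [toFinset_swapped, hQF, hPF] at h3
  rw [h2, h3]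
  have hM : 1 ≤ N * R.length := Nat.mul_pos hN hR1
  have hM' : (0 : ℝ) < N * R.length := by exact_mod_cast hM
  have h4 : ((N : ℝ) * R.length - 1) * (costT w R).val ≤
      N * R.length * (costT w (swapped R Ql Pl)).val := by
    have : (((N * R.length - 1) * (costT w R).val : ℕ) : ℝ) ≤
        (N * R.length * (costT w (swapped R Ql Pl)).val : ℕ) := by exact_mod_cast h1
    rw [Nat.cast_mul, Nat.cast_sub hM] at this
    push_cast at this
    exact this
  have e1 : 1 - 1 / ((N : ℝ) * R.length) = (N * R.length - 1) / (N * R.length) := by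
    field_simp
  rw [e1, div_mul_eq_mul_div, div_le_iff₀ hM']
  nlinarith

end

/-! ### Choice of constants and conclusion. -/

/-- With `B = ε⁻¹ ≥ 2` one has `1000 * B ≤ B ^ 11`, and `11 * 256000 = 2816000`; the remaining
`184000 * (d * B)` in the exponent absorbs the factor 32. -/
theorem swapSize_le_swapSizeO {ε d : ℝ} (hε : 0 < ε) (hε1 : ε ≤ 1 / 2) (hd : 1 ≤ d) :
    swapSize (ε / 1000) d ≤ swapSizeO 3000000 ε d := by
  set B : ℝ := ε⁻¹ with hB
  have hB2 : 2 ≤ B := by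
    rw [hB, le_inv_comm₀ (by norm_num) hε]
    linarith
  have hB0 : 0 < B := by linarith
  have hdB : 2 ≤ d * B := by nlinarith
  have e1 : (ε / 1000) ^ (-(256 * d / (ε / 1000))) = (1000 * B) ^ (256000 * (d * B)) := by
    rw [Real.rpow_neg (by positivity), ← Real.inv_rpow (by positivity)]
    congr 1
    · rw [hB]; field_simp
    · rw [hB]; field_simp; ring
  have e2 : ε ^ (-(3000000 * d / ε)) = B ^ (3000000 * (d * B)) := by
    rw [Real.rpow_neg hε.le, ← Real.inv_rpow hε.le]
    congr 1
    rw [hB]; field_simp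
  have h10 : (1000 : ℝ) ≤ B ^ 10 := by
    calc (1000 : ℝ) ≤ 2 ^ 10 := by norm_num
      _ ≤ B ^ 10 := by gcongr
  have h1 : (1000 * B) ^ (256000 * (d * B)) ≤ B ^ (2816000 * (d * B)) := by
    calc (1000 * B) ^ (256000 * (d * B)) ≤ (B ^ 10 * B) ^ (256000 * (d * B)) := by gcongr
      _ = B ^ (2816000 * (d * B)) := by
        rw [← pow_succ, ← Real.rpow_natCast, ← Real.rpow_mul hB0.le]
        congr 1
        push_cast
        ring
  have h2 : 32 ≤ B ^ (184000 * (d * B)) := by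
    calc (32 : ℝ) = 2 ^ 5 := by norm_num
      _ ≤ B ^ 5 := by gcongr
      _ = B ^ (5 : ℝ) := by norm_cast
      _ ≤ _ := Real.rpow_le_rpow_of_exponent_le (by linarith) (by linarith)
  have h3 : d ^ (16 * d) ≤ d ^ (3000000 * d) :=
    Real.rpow_le_rpow_of_exponent_le hd (by linarith)
  unfold swapSize swapSizeO
  rw [e1, e2]
  calc 32 * d ^ (16 * d) * (1000 * B) ^ (256000 * (d * B))
      ≤ B ^ (184000 * (d * B)) * d ^ (3000000 * d) * B ^ (2816000 * (d * B)) := by gcongr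
    _ = d ^ (3000000 * d) * (B ^ (184000 * (d * B)) * B ^ (2816000 * (d * B))) := by ring
    _ = _ := by
      rw [← Real.rpow_add hB0]
      congr 2
      ring

end KMeans

theorem theorem1 :
    -- Any local optimum for the explicit swap size costs at most `(1 + O(ε))` times any other
    -- solution with `k` centres; likewise for the stopping condition with tolerance `ε / k`.
    (∃ K ε₀ : ℝ, 0 < K ∧ 0 < ε₀ ∧ ε₀ < 1 ∧
      ∀ (V : Type u) [MetricSpace V] (d : ℝ), DoublingDimLE V d →
      ∀ (n m k : ℕ) (x : Fin n → V) (y : Fin m → V), 1 ≤ k →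
      ∀ ε : ℝ, 0 < ε → ε ≤ ε₀ →
      ∀ S : Finset (Fin m), S.card = k →
        (IsLocalOpt x y 0 (swapSize ε d) S ∨ IsLocalOpt x y (ε / k) (swapSize ε d) S) →
      ∀ O : Finset (Fin m), O.card = k → cost x y S ≤ (1 + K * ε) * cost x y O) ∧
    -- Hence local search with swaps of size `d ^ O(d) * ε ^ (-O(d / ε))` is a
    -- `(1 + ε)`-approximation, and its polynomial-step variant is a PTAS.
    (∃ (c : ℝ) (B : ℕ), 0 < c ∧ ∀ d ε : ℝ, 0 < ε → ε ≤ 1 / 2 →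
      (∀ (V : Type u) [MetricSpace V], DoublingDimLE V d →
        ∀ (n m k : ℕ) (x : Fin n → V) (y : Fin m → V), 1 ≤ k →
        ∀ S : Finset (Fin m), S.card = k → IsLocalOpt x y 0 (swapSizeO c ε d) S →
        ∀ O : Finset (Fin m), O.card = k → cost x y S ≤ (1 + ε) * cost x y O) ∧
      ∃ A : ℕ, ∀ (V : Type u) [MetricSpace V], DoublingDimLE V d →
        ∀ (n m k : ℕ) (x : Fin n → V) (y : Fin m → V), 1 ≤ k →
        ∀ (w : Fin n → Fin m → ℕ) (s : ℝ), 0 < s →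
          (∀ j i, dist (x j) (y i) ^ 2 = s * (w j i : ℝ)) →
        ∀ S₀ : List (Fin m), S₀.Nodup → S₀.length = k →
        ∃ (R : List (Fin m)) (t : ℕ),
          Runs w ⌊swapSizeO c ε d⌋₊ ⌈c / ε⌉₊ S₀ R t ∧
          t ≤ A * inputSize w ^ (B * (⌊swapSizeO c ε d⌋₊ + 1)) ∧
          R.Nodup ∧ R.length = k ∧
          ∀ O : Finset (Fin m), O.card = k →
            cost x y R.toFinset ≤ (1 + ε) * cost x y O) ∧
    -- The number of improvements that the variant with tolerance `ε / k` can perform.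
    (∀ (V : Type u) [MetricSpace V] (n m k : ℕ) (x : Fin n → V) (y : Fin m → V), 1 ≤ k →
      ∀ ε ρ : ℝ, 0 < ε → ε < 1 →
      ∀ O : Finset (Fin m), O.card = k → 0 < cost x y O →
        (∀ T : Finset (Fin m), T.card = k → cost x y O ≤ cost x y T) →
      ∀ (t : ℕ) (S : ℕ → Finset (Fin m)), (S 0).card = k →
        (∀ i < t, IsSwap ρ (S i) (S (i + 1)) ∧
          cost x y (S (i + 1)) < (1 - ε / k) * cost x y (S i)) →
        (t : ℝ) ≤ Real.log (cost x y (S 0) / cost x y O) / Real.log (1 / (1 - ε / k))) := by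
  refine ⟨⟨1000, 1 / 1000, by norm_num, by norm_num, by norm_num, ?_⟩,
    ⟨3000000, 5, by norm_num, fun d ε hε hε1 => ⟨?_, ?_⟩⟩, ?_⟩
  · intro V _ d hV n m k x y hk ε hε hε1 S hS hloc O hO
    rcases hV.one_le_or_subsingleton with hd | hsub
    · have hk' : (0 : ℝ) < k := by exact_mod_cast hk
      rcases hloc with hloc | hloc
      · exact cost_le_of_isLocalOpt hV hd hk hε hε1 le_rfl (by simpa using hε.le) hS hO hloc
      · exact cost_le_of_isLocalOpt hV hd hk hε hε1 (by positivity)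
          (div_mul_cancel₀ _ hk'.ne').le hS hO hloc
    · rw [cost_eq_zero_of_subsingleton (Finset.card_pos.1 (by omega)),
        cost_eq_zero_of_subsingleton (Finset.card_pos.1 (by omega)), mul_zero]
  · intro V _ hV n m k x y hk S hS hloc O hO
    rcases hV.one_le_or_subsingleton with hd | hsub
    · have := cost_le_of_isLocalOpt hV hd hk (e := ε / 1000) (by positivity) (by linarith) le_rfl
        (by rw [zero_mul]; positivity) hS hO (hloc.mono le_rfl (swapSize_le_swapSizeO hε hε1 hd))
      rwa [mul_div_cancel₀ ε (by norm_num : (1000 : ℝ) ≠ 0)] at this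
    · rw [cost_eq_zero_of_subsingleton (Finset.card_pos.1 (by omega)),
        cost_eq_zero_of_subsingleton (Finset.card_pos.1 (by omega)), mul_zero]
  · obtain ⟨A, hA⟩ := exists_runs_le ⌊swapSizeO 3000000 ε d⌋₊ ⌈3000000 / ε⌉₊
    refine ⟨A, ?_⟩
    intro V _ hV n m k x y hk w s hs hw S₀ hS₀ hS₀k
    have hne : S₀ ≠ [] := List.ne_nil_of_length_pos (by omega)
    obtain ⟨R, t, h1, h2, h3, h4, h5⟩ := hA w S₀ hS₀ hne
    have hRk : R.length = k := h4.trans hS₀k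
    refine ⟨R, t, h1, h2, h3, hRk, fun O hO => ?_⟩
    have hRne : R ≠ [] := List.ne_nil_of_length_pos (by omega)
    have hRcard : R.toFinset.card = k := (List.toFinset_card_of_nodup h3).trans hRk
    rcases hV.one_le_or_subsingleton with hd | hsub
    · have hk' : (0 : ℝ) < k := by exact_mod_cast hk
      have hNpos : 0 < 3000000 / ε := by positivity
      have hloc := isLocalOpt_of_improveT hs hw (Nat.ceil_pos.2 hNpos) h3 hRne h5
      -- The guarantee is used with `e = ε / 1000`, so the stopping tolerance must be at most `e /
      -- k`; any `N ≥ 1000 / ε` would do.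
      have htol : 1 / ((⌈3000000 / ε⌉₊ : ℝ) * R.length) ≤ ε / 1000 / k := by
        rw [hRk]
        have h6 : 3000000 / ε ≤ ⌈3000000 / ε⌉₊ := Nat.le_ceil _
        have h7 : 1000 / ε ≤ ⌈3000000 / ε⌉₊ :=
          le_trans (div_le_div_of_nonneg_right (by norm_num) hε.le) h6
        calc 1 / ((⌈3000000 / ε⌉₊ : ℝ) * k) ≤ 1 / (1000 / ε * k) := by gcongr
          _ = ε / 1000 / k := by field_simp
      have := cost_le_of_isLocalOpt hV hd hk (e := ε / 1000) (by positivity) (by linarith)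
        (by positivity) (div_mul_cancel₀ _ hk'.ne').le hRcard hO
        (hloc.mono htol (swapSize_le_swapSizeO hε hε1 hd))
      rwa [mul_div_cancel₀ ε (by norm_num : (1000 : ℝ) ≠ 0)] at this
    · rw [cost_eq_zero_of_subsingleton (Finset.card_pos.1 (by omega)),
        cost_eq_zero_of_subsingleton (Finset.card_pos.1 (by omega)), mul_zero]
  · intro V _ n m k x y hk ε ρ hε hε1 O _ hO0 hOmin t S hS hstep
    exact improvement_count_le hk hε hε1 hO0 hOmin t S hS hstep
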